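/- Let $p_1,\dots,p_n$ ($n\ge 1$) be distinct points in the plane, each of which has a colour. A subset $S$ of the points is a consistent subset if for every point $p$ not in $S$ the closest point to $p$ in $S$ (Euclidean distance) exists and has the same colour as $p$; if several points of $S$ are closest to $p$, this may be read as a condition on all of them or as a condition on at least one of them, and the theorem holds for either reading. A minimum consistent subset is a consistent subset with the smallest number of points. Theorem. A minimum consistent subset of $n$ coloured points that lie on two parallel lines can be computed in $O(n^6)$ time. That is, there are a real RAM program (unit cost; natural numbers with addition, subtraction and comparison, real numbers with the four arithmetic operations and comparison, arrays with indirect addressing, no rounding) and a constant $C$ such that for every $n\ge 1$ and all distinct points $p_1,\dots,p_n$ in the plane for which there are two parallel lines whose union contains them, with arbitrary colours (given as natural numbers), the program, on input of the coordinates and the colours in any order of the points and without the two lines, halts after at most $C\,n^6$ steps and returns a minimum consistent subset. -/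

import Mathlib

/-! ## The real RAM

A program handles natural numbers (used for counting, for colours and as array indices) and real
numbers (used for coordinates).  It has scalar variables and one-dimensional unbounded arrays of
both kinds; a program is a finite text, so it uses finitely many of them.  Natural numbers can be
added, subtracted and compared; real numbers can be added, subtracted, multiplied, divided and
compared.  There is no multiplication of natural numbers, no rounding and no other passage from
real numbers to natural numbers, and the only constants are natural numbers.  Every operation,
comparison, memory access and assignment takes one unit of time. -/

namespace RealRAM

/-- Expressions with values in `ℕ`; `get A e` reads the cell with index `e` of array number `A`. -/
inductive NExp : Type
  | const (c : ℕ)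
  | var (v : ℕ)
  | get (A : ℕ) (e : NExp)
  | add (e₁ e₂ : NExp)
  | sub (e₁ e₂ : NExp)

/-- Expressions with values in `ℝ`; `get A e` reads the cell with index `e` of array number `A`. -/
inductive RExp : Type
  | const (c : ℕ)
  | var (v : ℕ)
  | get (A : ℕ) (e : NExp)
  | add (e₁ e₂ : RExp)
  | sub (e₁ e₂ : RExp)
  | mul (e₁ e₂ : RExp)
  | div (e₁ e₂ : RExp)

/-- Tests. -/
inductive Test : Type
  | nlt (e₁ e₂ : NExp)
  | neq (e₁ e₂ : NExp)
  | rlt (e₁ e₂ : RExp)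
  | req (e₁ e₂ : RExp)
  | neg (b : Test)
  | both (b₁ b₂ : Test)

/-- Programs. -/
inductive Prog : Type
  | skip
  | setN (v : ℕ) (e : NExp)
  | setR (v : ℕ) (e : RExp)
  | putN (A : ℕ) (i : NExp) (e : NExp)
  | putR (A : ℕ) (i : NExp) (e : RExp)
  | seq (c₁ c₂ : Prog)
  | branch (b : Test) (c₁ c₂ : Prog)
  | loop (b : Test) (c : Prog)

/-- Contents of the memory: scalar variables and arrays of natural numbers and of real numbers. -/
structure State : Type where
  nvar : ℕ → ℕ
  rvar : ℕ → ℝ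
  narr : ℕ → ℕ → ℕ
  rarr : ℕ → ℕ → ℝ

/-- Subtraction of natural numbers is truncated at `0`. -/
def NExp.eval (s : State) : NExp → ℕ
  | .const c => c
  | .var v => s.nvar v
  | .get A e => s.narr A (e.eval s)
  | .add e₁ e₂ => e₁.eval s + e₂.eval s
  | .sub e₁ e₂ => e₁.eval s - e₂.eval s

/-- Division by zero returns `0`. -/
noncomputable def RExp.eval (s : State) : RExp → ℝ
  | .const c => (c : ℝ)
  | .var v => s.rvar v
  | .get A e => s.rarr A (e.eval s)
  | .add e₁ e₂ => e₁.eval s + e₂.eval s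
  | .sub e₁ e₂ => e₁.eval s - e₂.eval s
  | .mul e₁ e₂ => e₁.eval s * e₂.eval s
  | .div e₁ e₂ => e₁.eval s / e₂.eval s

def Test.Holds (s : State) : Test → Prop
  | .nlt e₁ e₂ => e₁.eval s < e₂.eval s
  | .neq e₁ e₂ => e₁.eval s = e₂.eval s
  | .rlt e₁ e₂ => e₁.eval s < e₂.eval s
  | .req e₁ e₂ => e₁.eval s = e₂.eval s
  | .neg b => ¬ b.Holds s
  | .both b₁ b₂ => b₁.Holds s ∧ b₂.Holds s

/-- The time to evaluate an expression or a test is the number of its constituents. -/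
def NExp.cost : NExp → ℕ
  | .const _ => 1
  | .var _ => 1
  | .get _ e => e.cost + 1
  | .add e₁ e₂ => e₁.cost + e₂.cost + 1
  | .sub e₁ e₂ => e₁.cost + e₂.cost + 1

def RExp.cost : RExp → ℕ
  | .const _ => 1
  | .var _ => 1
  | .get _ e => e.cost + 1
  | .add e₁ e₂ => e₁.cost + e₂.cost + 1
  | .sub e₁ e₂ => e₁.cost + e₂.cost + 1
  | .mul e₁ e₂ => e₁.cost + e₂.cost + 1
  | .div e₁ e₂ => e₁.cost + e₂.cost + 1

def Test.cost : Test → ℕ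
  | .nlt e₁ e₂ => e₁.cost + e₂.cost + 1
  | .neq e₁ e₂ => e₁.cost + e₂.cost + 1
  | .rlt e₁ e₂ => e₁.cost + e₂.cost + 1
  | .req e₁ e₂ => e₁.cost + e₂.cost + 1
  | .neg b => b.cost + 1
  | .both b₁ b₂ => b₁.cost + b₂.cost + 1

/-- `Runs c s t s'`: program `c`, started in state `s`, halts after exactly `t` units of time, in
state `s'`. -/
inductive Runs : Prog → State → ℕ → State → Prop
  | skip (s : State) : Runs .skip s 1 s
  | setN (v : ℕ) (e : NExp) (s : State) :
      Runs (.setN v e) s (e.cost + 1)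
        { s with nvar := Function.update s.nvar v (e.eval s) }
  | setR (v : ℕ) (e : RExp) (s : State) :
      Runs (.setR v e) s (e.cost + 1)
        { s with rvar := Function.update s.rvar v (e.eval s) }
  | putN (A : ℕ) (i e : NExp) (s : State) :
      Runs (.putN A i e) s (i.cost + e.cost + 1)
        { s with narr :=
            Function.update s.narr A (Function.update (s.narr A) (i.eval s) (e.eval s)) }
  | putR (A : ℕ) (i : NExp) (e : RExp) (s : State) :
      Runs (.putR A i e) s (i.cost + e.cost + 1)
        { s with rarr :=
            Function.update s.rarr A (Function.update (s.rarr A) (i.eval s) (e.eval s)) }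
  | seq {c₁ c₂ : Prog} {s s' s'' : State} {t₁ t₂ : ℕ} :
      Runs c₁ s t₁ s' → Runs c₂ s' t₂ s'' → Runs (.seq c₁ c₂) s (t₁ + t₂) s''
  | branch_true {b : Test} {c₁ c₂ : Prog} {s s' : State} {t : ℕ} :
      b.Holds s → Runs c₁ s t s' → Runs (.branch b c₁ c₂) s (b.cost + 1 + t) s'
  | branch_false {b : Test} {c₁ c₂ : Prog} {s s' : State} {t : ℕ} :
      ¬ b.Holds s → Runs c₂ s t s' → Runs (.branch b c₁ c₂) s (b.cost + 1 + t) s'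
  | loop_done {b : Test} {c : Prog} {s : State} :
      ¬ b.Holds s → Runs (.loop b c) s (b.cost + 1) s
  | loop_step {b : Test} {c : Prog} {s s' s'' : State} {t₁ t₂ : ℕ} :
      b.Holds s → Runs c s t₁ s' → Runs (.loop b c) s' t₂ s'' →
        Runs (.loop b c) s (b.cost + 1 + t₁ + t₂) s''

end RealRAM

/-! ## Consistent subsets -/

/-- Among the points of `S`, none is closer to point `i` than point `j` of `S` is. -/
def IsClosest {n : ℕ} (p : Fin n → EuclideanSpace ℝ (Fin 2)) (S : Finset (Fin n))
    (i j : Fin n) : Prop :=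
  j ∈ S ∧ ∀ k ∈ S, dist (p i) (p j) ≤ dist (p i) (p k)

/-- The two ways to read "the closest point of `S` has the same colour" when several points of
`S` are closest: all of them have this colour, or at least one of them has. -/
inductive TieRule : Type
  | all
  | some

/-- Some point of `S` is closest to point `i`, and the closest point has the colour of `i`. -/
def ClosestHasSameColor {n : ℕ} (p : Fin n → EuclideanSpace ℝ (Fin 2)) (col : Fin n → ℕ)
    (S : Finset (Fin n)) (i : Fin n) : TieRule → Prop
  | .all => (∃ j, IsClosest p S i j) ∧ ∀ j, IsClosest p S i j → col j = col i
  | .some => ∃ j, IsClosest p S i j ∧ col j = col i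

def IsConsistentSubset (tie : TieRule) {n : ℕ} (p : Fin n → EuclideanSpace ℝ (Fin 2))
    (col : Fin n → ℕ) (S : Finset (Fin n)) : Prop :=
  ∀ i, i ∉ S → ClosestHasSameColor p col S i tie

def IsMinConsistentSubset (tie : TieRule) {n : ℕ} (p : Fin n → EuclideanSpace ℝ (Fin 2))
    (col : Fin n → ℕ) (S : Finset (Fin n)) : Prop :=
  IsConsistentSubset tie p col S ∧
    ∀ T : Finset (Fin n), IsConsistentSubset tie p col T → S.card ≤ T.card

/-- Every point lies on one of two parallel straight lines.  (Points on a single line are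
included, as the other line may carry no point.) -/
def OnTwoParallelLines {n : ℕ} (p : Fin n → EuclideanSpace ℝ (Fin 2)) : Prop :=
  ∃ L₁ L₂ : AffineSubspace ℝ (EuclideanSpace ℝ (Fin 2)),
    Module.finrank ℝ L₁.direction = 1 ∧ L₁.Parallel L₂ ∧ ∀ i, p i ∈ L₁ ∨ p i ∈ L₂

/-! ## Input and output -/

/-- The memory at the start: the scalar `0` holds the number `n` of points, array `0` of natural
numbers holds the colours, arrays `0` and `1` of real numbers hold the first and second
coordinates of the points, and everything else is `0`. -/
noncomputable def inputState {n : ℕ} (p : Fin n → EuclideanSpace ℝ (Fin 2)) (col : Fin n → ℕ) :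
    RealRAM.State where
  nvar v := if v = 0 then n else 0
  rvar _ := 0
  narr A k := if h : k < n then (if A = 0 then col ⟨k, h⟩ else 0) else 0
  rarr A k :=
    if h : k < n then (if A = 0 then p ⟨k, h⟩ 0 else if A = 1 then p ⟨k, h⟩ 1 else 0) else 0

/-- The subset that is returned is written to array `1` of natural numbers, as a vector of ones
(points in the subset) and zeros (points outside of it). -/
def Returns {n : ℕ} (s : RealRAM.State) (S : Finset (Fin n)) : Prop :=
  ∀ i : Fin n, s.narr 1 i = if i ∈ S then 1 else 0

namespace RealRAM

/-! ## Programs with counting loops -/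

/-! Sort the points by their projection to the common direction of the two lines. Within one line,
the points on one side of a given point in this order get strictly farther from it. Hence, for a
point outside of a subset `S`, all closest points of `S` are among four candidates: on each line,
the last point of `S` before it and the first one after it (`closest_iff`, resting on
`Holds.sqDist_lt`). So consistency of `S` is a condition on each point and its four candidates, and
a left-to-right dynamic program over these four candidates finds a smallest `S`.

The two "next" candidates are guesses about the future. A guess is made when a selected position is
left, and it checks itself: a position counts as selected exactly when the guess for its row names
it. A guess in the wrong row or in the past is never met, stays in its cell, and is rejected at the
end, where both guesses must be `N`, that is, "none". The recursion `value` is at most the size of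
every admissible set (`value_stateOf_le`). Conversely, following optimal guesses selects a set of
that size (`value_optimal`) whose true candidates are the guessed ones (`optimal_eq_stateOf`).
Together these give `selected_minimal`. Two dummy positions `0` and `1`, one in each row and always
selected, make the initial sweep state unique; they add `2` to every cardinality and never count as
candidates.

With `N = n + 2`, a position and four cells give `(N + 1) ^ 5` table entries, each with at most `N +
1` guesses to try, hence the exponent `6`. Table addresses are numbers in base `N + 1`, read off
from tables of multiples, as the machine cannot multiply natural numbers. The direction is found by
trying all pairs of points against all pairs, in time of order `n ^ 4`. The program uses only
counting loops with one fixed bound, so its running time follows from the nesting depth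
(`runs_toProg`) and its correctness from invariants (`fillTable_spec`, `markSelected_spec`). -/

/-- The state in which the scalar variable `v` has been set to `a`. -/
def State.setVar (s : State) (v a : ℕ) : State :=
  { s with nvar := Function.update s.nvar v a }

/-- The state in which cell `i` of array `A` of natural numbers has been set to `a`. -/
def State.putCell (s : State) (A i a : ℕ) : State :=
  { s with narr := Function.update s.narr A (Function.update (s.narr A) i a) }

@[simp] theorem State.setVar_nvar (s : State) (v a u : ℕ) :
    (s.setVar v a).nvar u = if u = v then a else s.nvar u := by
  simp [State.setVar, Function.update_apply]

@[simp] theorem State.setVar_narr (s : State) (v a : ℕ) : (s.setVar v a).narr = s.narr := rfl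

@[simp] theorem State.setVar_rarr (s : State) (v a : ℕ) : (s.setVar v a).rarr = s.rarr := rfl

@[simp] theorem State.putCell_nvar (s : State) (A i a : ℕ) :
    (s.putCell A i a).nvar = s.nvar := rfl

@[simp] theorem State.putCell_rarr (s : State) (A i a : ℕ) :
    (s.putCell A i a).rarr = s.rarr := rfl

@[simp] theorem State.putCell_narr (s : State) (A i a B : ℕ) :
    (s.putCell A i a).narr B = if B = A then Function.update (s.narr A) i a else s.narr B := by
  simp only [State.putCell, Function.update_apply]

/-- Programs on natural numbers in which every loop is a counting loop: `count v c` runs `c` with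
the variable `v` set to `0, 1, …, m - 1`, where `m` is the value of the variable `1`. -/
inductive ForProg : Type
  | skip
  | setN (v : ℕ) (e : NExp)
  | putN (A : ℕ) (i : NExp) (e : NExp)
  | seq (c₁ c₂ : ForProg)
  | branch (b : Test) (c₁ c₂ : ForProg)
  | count (v : ℕ) (c : ForProg)

namespace ForProg

/-- The real RAM program of a program with counting loops. -/
def toProg : ForProg → Prog
  | skip => .skip
  | setN v e => .setN v e
  | putN A i e => .putN A i e
  | seq c₁ c₂ => .seq c₁.toProg c₂.toProg
  | branch b c₁ c₂ => .branch b c₁.toProg c₂.toProg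
  | count v c => .seq (.setN v (.const 0)) (.loop (.nlt (.var v) (.var 1))
      (.seq c.toProg (.setN v (.add (.var v) (.const 1)))))

/-- The state after `k` rounds of a counting loop with variable `v` and body `f`. -/
def rounds (f : State → State) (v : ℕ) (s : State) : ℕ → State
  | 0 => s.setVar v 0
  | k + 1 => (f (rounds f v s k)).setVar v (k + 1)

open Classical in
/-- The final state as a function of the initial state. -/
noncomputable def eval : ForProg → State → State
  | skip, s => s
  | setN v e, s => s.setVar v (e.eval s)
  | putN A i e, s => s.putCell A (i.eval s) (e.eval s)
  | seq c₁ c₂, s => c₂.eval (c₁.eval s)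
  | branch b c₁ c₂, s => if b.Holds s then c₁.eval s else c₂.eval s
  | count v c, s => rounds c.eval v s (s.nvar 1)

theorem eval_seq (c₁ c₂ : ForProg) (s : State) :
    (seq c₁ c₂).eval s = c₂.eval (c₁.eval s) := rfl

open Classical in
theorem eval_branch (b : Test) (c₁ c₂ : ForProg) (s : State) :
    (branch b c₁ c₂).eval s = if b.Holds s then c₁.eval s else c₂.eval s := rfl

/-- The scalar variables that a program may change. -/
def vars : ForProg → List ℕ
  | skip => []
  | setN v _ => [v]
  | putN _ _ _ => []
  | seq c₁ c₂ => c₁.vars ++ c₂.vars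
  | branch _ c₁ c₂ => c₁.vars ++ c₂.vars
  | count v c => v :: c.vars

/-- The arrays that a program may change. -/
def arrs : ForProg → List ℕ
  | skip => []
  | setN _ _ => []
  | putN A _ _ => [A]
  | seq c₁ c₂ => c₁.arrs ++ c₂.arrs
  | branch _ c₁ c₂ => c₁.arrs ++ c₂.arrs
  | count _ c => c.arrs

/-- The loop bound is never changed, nor is a loop variable in the body of its loop. -/
def proper : ForProg → Bool
  | skip => true
  | setN v _ => v != 1
  | putN _ _ _ => true
  | seq c₁ c₂ => c₁.proper && c₂.proper
  | branch _ c₁ c₂ => c₁.proper && c₂.proper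
  | count v c => v != 1 && !c.vars.contains v && c.proper

/-- The nesting depth of the loops. -/
def depth : ForProg → ℕ
  | skip => 0
  | setN _ _ => 0
  | putN _ _ _ => 0
  | seq c₁ c₂ => max c₁.depth c₂.depth
  | branch _ c₁ c₂ => max c₁.depth c₂.depth
  | count _ c => c.depth + 1

/-- The constant factor of the running time. -/
def factor : ForProg → ℕ
  | skip => 1
  | setN _ e => e.cost + 1
  | putN _ i e => i.cost + e.cost + 1
  | seq c₁ c₂ => c₁.factor + c₂.factor
  | branch b c₁ c₂ => b.cost + 1 + (c₁.factor + c₂.factor)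
  | count _ c => c.factor + 14

/-! ### Frame properties: what a program leaves unchanged -/

theorem eval_nvar (c : ForProg) (s : State) {u : ℕ} (hu : u ∉ c.vars) :
    (c.eval s).nvar u = s.nvar u := by
  induction c generalizing s with
  | skip => rfl
  | setN v e => simp_all [eval, vars]
  | putN A i e => rfl
  | seq c₁ c₂ h₁ h₂ =>
    simp only [vars, List.mem_append, not_or] at hu
    rw [eval, h₂ _ hu.2, h₁ _ hu.1]
  | branch b c₁ c₂ h₁ h₂ =>
    simp only [vars, List.mem_append, not_or] at hu
    rw [eval]
    split_ifs
    · exact h₁ _ hu.1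
    · exact h₂ _ hu.2
  | count v c h =>
    simp only [vars, List.mem_cons, not_or] at hu
    rw [eval]
    generalize s.nvar 1 = k
    induction k with
    | zero => simp [rounds, hu.1]
    | succ k ih => simp [rounds, hu.1, h _ hu.2, ih]

theorem eval_narr (c : ForProg) (s : State) {A : ℕ} (hA : A ∉ c.arrs) :
    (c.eval s).narr A = s.narr A := by
  induction c generalizing s with
  | skip => rfl
  | setN v e => rfl
  | putN A i e => simp_all [eval, arrs]
  | seq c₁ c₂ h₁ h₂ =>
    simp only [arrs, List.mem_append, not_or] at hA
    rw [eval, h₂ _ hA.2, h₁ _ hA.1]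
  | branch b c₁ c₂ h₁ h₂ =>
    simp only [arrs, List.mem_append, not_or] at hA
    rw [eval]
    split_ifs
    · exact h₁ _ hA.1
    · exact h₂ _ hA.2
  | count v c h =>
    simp only [arrs] at hA
    rw [eval]
    generalize s.nvar 1 = k
    induction k with
    | zero => rfl
    | succ k ih => simp [rounds, h _ hA, ih]

@[simp] theorem eval_rarr (c : ForProg) (s : State) : (c.eval s).rarr = s.rarr := by
  induction c generalizing s with
  | skip => rfl
  | setN v e => rfl
  | putN A i e => rfl
  | seq c₁ c₂ h₁ h₂ => rw [eval, h₂, h₁]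
  | branch b c₁ c₂ h₁ h₂ =>
    rw [eval]
    split_ifs
    · exact h₁ _
    · exact h₂ _
  | count v c h =>
    rw [eval]
    generalize s.nvar 1 = k
    induction k with
    | zero => rfl
    | succ k ih => simp [rounds, h, ih]

theorem one_notMem_vars {c : ForProg} (hc : c.proper = true) : 1 ∉ c.vars := by
  induction c with
  | skip => simp [vars]
  | setN v e =>
    simp only [proper, bne_iff_ne] at hc
    simpa [vars] using Ne.symm hc
  | putN A i e => simp [vars]
  | seq c₁ c₂ h₁ h₂ =>
    simp only [proper, Bool.and_eq_true] at hc
    simp [vars, h₁ hc.1, h₂ hc.2]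
  | branch b c₁ c₂ h₁ h₂ =>
    simp only [proper, Bool.and_eq_true] at hc
    simp [vars, h₁ hc.1, h₂ hc.2]
  | count v c h =>
    simp only [proper, Bool.and_eq_true, bne_iff_ne, ne_eq] at hc
    simp only [vars, List.mem_cons, not_or]
    exact ⟨Ne.symm hc.1.1, h hc.2⟩

/-! ### Rounds of a loop and running time -/

theorem rounds_nvar_self (f : State → State) (v : ℕ) (s : State) (k : ℕ) :
    (rounds f v s k).nvar v = k := by
  cases k <;> simp [rounds]

theorem rounds_nvar {c : ForProg} {v u : ℕ} (hu : u ∉ (count v c).vars) (s : State) (k : ℕ) :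
    (rounds c.eval v s k).nvar u = s.nvar u := by
  simp only [vars, List.mem_cons, not_or] at hu
  induction k with
  | zero => simp [rounds, hu.1]
  | succ k ih => simp [rounds, hu.1, eval_nvar _ _ hu.2, ih]

theorem rounds_narr {c : ForProg} {v A : ℕ} (hA : A ∉ c.arrs) (s : State) (k : ℕ) :
    (rounds c.eval v s k).narr A = s.narr A := by
  induction k with
  | zero => rfl
  | succ k ih => simp [rounds, eval_narr _ _ hA, ih]

theorem rounds_rarr (c : ForProg) (v : ℕ) (s : State) (k : ℕ) :
    (rounds c.eval v s k).rarr = s.rarr := by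
  induction k with
  | zero => rfl
  | succ k ih => simp [rounds, ih]

/-- Induction on the number `j` of remaining rounds. Beyond the body, a round costs `4` for the test
and `4` for the increment; the final failing test costs `4`. -/
theorem runs_loop {c : ForProg} {v m B : ℕ} {s : State} (hv : v ≠ 1) (hvc : v ∉ c.vars)
    (h1 : 1 ∉ c.vars) (hm : s.nvar 1 = m)
    (hB : ∀ s : State, s.nvar 1 = m → ∃ t ≤ B, Runs c.toProg s t (c.eval s)) (j : ℕ) :
    ∀ k, k + j = m → ∃ t ≤ j * (B + 8) + 4,
      Runs (.loop (.nlt (.var v) (.var 1))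
        (.seq c.toProg (.setN v (.add (.var v) (.const 1))))) (rounds c.eval v s k) t
        (rounds c.eval v s m) := by
  have hr : ∀ k, (rounds c.eval v s k).nvar 1 = m := fun k => by
    rw [rounds_nvar (by simp [vars, h1, Ne.symm hv]), hm]
  induction j with
  | zero =>
    intro k hk
    obtain rfl : k = m := by omega
    refine ⟨4, by omega, ?_⟩
    exact Runs.loop_done (by simp [Test.Holds, NExp.eval, hr, rounds_nvar_self])
  | succ j ih =>
    intro k hk
    obtain ⟨t₂, ht₂, hR₂⟩ := ih (k + 1) (by omega)
    obtain ⟨t₁, ht₁, hR₁⟩ := hB _ (hr k)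
    have hR : Runs (.seq c.toProg (.setN v (.add (.var v) (.const 1)))) (rounds c.eval v s k)
        (t₁ + 4) (rounds c.eval v s (k + 1)) := by
      have h := Runs.seq hR₁ (Runs.setN v (.add (.var v) (.const 1)) _)
      have he : (NExp.add (.var v) (.const 1)).eval (c.eval (rounds c.eval v s k)) = k + 1 := by
        simp [NExp.eval, eval_nvar _ _ hvc, rounds_nvar_self]
      rw [he] at h
      exact h
    refine ⟨_, ?_, Runs.loop_step ?_ hR hR₂⟩
    · simp only [Test.cost, NExp.cost]
      linarith [Nat.succ_mul j (B + 8)]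
    · simp only [Test.Holds, NExp.eval, hr, rounds_nvar_self]
      omega

/-- The running time is at most a constant times the loop bound to the power of the depth. -/
theorem runs_toProg (c : ForProg) (hc : c.proper = true) (s : State) (hs : 1 ≤ s.nvar 1) :
    ∃ t ≤ c.factor * s.nvar 1 ^ c.depth, Runs c.toProg s t (c.eval s) := by
  induction c generalizing s with
  | skip => exact ⟨1, by simp [factor, depth], Runs.skip s⟩
  | setN v e => exact ⟨_, by simp [factor, depth], Runs.setN v e s⟩
  | putN A i e => exact ⟨_, by simp [factor, depth], Runs.putN A i e s⟩
  | seq c₁ c₂ h₁ h₂ =>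
    simp only [proper, Bool.and_eq_true] at hc
    obtain ⟨t₁, ht₁, hR₁⟩ := h₁ hc.1 s hs
    have h1 := eval_nvar c₁ s (one_notMem_vars hc.1)
    obtain ⟨t₂, ht₂, hR₂⟩ := h₂ hc.2 (c₁.eval s) (by rw [h1]; exact hs)
    refine ⟨_, ?_, Runs.seq hR₁ hR₂⟩
    rw [h1] at ht₂
    rw [factor, depth, add_mul]
    refine add_le_add (ht₁.trans ?_) (ht₂.trans ?_)
    · gcongr; exact le_max_left _ _
    · gcongr; exact le_max_right _ _
  | branch b c₁ c₂ h₁ h₂ =>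
    simp only [proper, Bool.and_eq_true] at hc
    have hp : 1 ≤ s.nvar 1 ^ max c₁.depth c₂.depth := Nat.one_le_pow _ _ hs
    have hb : b.cost + 1 ≤ (b.cost + 1) * s.nvar 1 ^ max c₁.depth c₂.depth :=
      Nat.le_mul_of_pos_right _ hp
    rw [eval]
    split_ifs with h
    · obtain ⟨t, ht, hR⟩ := h₁ hc.1 s hs
      refine ⟨_, ?_, Runs.branch_true h hR⟩
      have : c₁.factor * s.nvar 1 ^ c₁.depth ≤
          (c₁.factor + c₂.factor) * s.nvar 1 ^ max c₁.depth c₂.depth :=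
        Nat.mul_le_mul (Nat.le_add_right _ _) (Nat.pow_le_pow_right hs (le_max_left _ _))
      rw [factor, depth, add_mul]
      omega
    · obtain ⟨t, ht, hR⟩ := h₂ hc.2 s hs
      refine ⟨_, ?_, Runs.branch_false h hR⟩
      have : c₂.factor * s.nvar 1 ^ c₂.depth ≤
          (c₁.factor + c₂.factor) * s.nvar 1 ^ max c₁.depth c₂.depth :=
        Nat.mul_le_mul (Nat.le_add_left _ _) (Nat.pow_le_pow_right hs (le_max_right _ _))
      rw [factor, depth, add_mul]
      omega
  | count v c h =>
    simp only [proper, Bool.and_eq_true, bne_iff_ne, ne_eq, Bool.not_eq_true',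
      List.contains_eq_mem, decide_eq_false_iff_not] at hc
    obtain ⟨⟨hv, hvc⟩, hc⟩ := hc
    set m := s.nvar 1 with hm
    -- The same time bound serves every round, because the body never changes variable `1`.
    obtain ⟨t, ht, hR⟩ := runs_loop (s := s) (m := m) (B := c.factor * m ^ c.depth) hv hvc
      (one_notMem_vars hc) rfl (fun s' hs' => by
        obtain ⟨t, ht, hR⟩ := h hc s' (by rw [hs']; exact hs)
        exact ⟨t, by rwa [hs'] at ht, hR⟩) m 0 (by simp)
    refine ⟨_, ?_, Runs.seq (Runs.setN v (.const 0) s) hR⟩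
    -- The `14` in `factor` is `2` for the initial assignment, `4` for the last test and `8` for
    -- each round.
    have hp : m ≤ m ^ (c.depth + 1) := Nat.le_self_pow (by omega) m
    have hp' : m ^ (c.depth + 1) = m ^ c.depth * m := pow_succ _ _
    simp only [NExp.cost, factor, depth]
    nlinarith

/-! ### Invariants of loops -/

/-- The invariant only has to mention what the loop changes: everything outside of `vars` and `arrs`
is supplied as unchanged in each round. -/
theorem count_induction {v : ℕ} {c : ForProg} {s : State} (I : ℕ → State → Prop)
    (h0 : I 0 (s.setVar v 0))
    (hs : ∀ k < s.nvar 1, ∀ s' : State, s'.nvar v = k →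
      (∀ u, u ∉ (count v c).vars → s'.nvar u = s.nvar u) →
      (∀ A, A ∉ c.arrs → s'.narr A = s.narr A) → s'.rarr = s.rarr →
      I k s' → I (k + 1) ((c.eval s').setVar v (k + 1))) :
    I (s.nvar 1) ((count v c).eval s) := by
  rw [eval]
  have : ∀ k ≤ s.nvar 1, I k (rounds c.eval v s k) := by
    intro k
    induction k with
    | zero => exact fun _ => h0
    | succ k ih =>
      intro hk
      exact hs k hk _ (rounds_nvar_self _ _ _ _) (fun u hu => rounds_nvar hu s k)
        (fun A hA => rounds_narr hA s k) (rounds_rarr c v s k) (ih (by omega))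
  exact this _ le_rfl

/-- Nested counting loops. -/
def nest (l : List ℕ) (c : ForProg) : ForProg := l.foldr count c

theorem nest_preserves {l : List ℕ} {c : ForProg} {P : State → Prop} {m : ℕ} (hl : l.Nodup)
    (hlc : ∀ v ∈ l, v ∉ c.vars) (hm : ∀ s, P s → s.nvar 1 = m)
    (hset : ∀ v ∈ l, ∀ s k, P s → P (s.setVar v k))
    (hc : ∀ s, P s → (∀ v ∈ l, s.nvar v < m) → P (c.eval s)) {s : State} (h : P s) :
    P ((nest l c).eval s) := by
  induction l generalizing P s with
  | nil => exact hc s h (by simp)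
  | cons v l ih =>
    rw [List.nodup_cons] at hl
    simp only [List.mem_cons, forall_eq_or_imp] at hlc hset hc
    refine count_induction (c := nest l c) (fun _ => P) (hset.1 _ _ h) ?_
    intro k hk s' hs' _ _ _ hP
    rw [hm s h] at hk
    -- The bound on the outer loop variable becomes part of the property preserved by the inner
    -- loops.
    refine hset.1 _ _ (And.left (b := ((nest l c).eval s').nvar v < m) ?_)
    refine ih (P := fun s => P s ∧ s.nvar v < m) hl.2 hlc.2 (fun s h => hm s h.1) ?_ ?_
      ⟨hP, by omega⟩
    · rintro u hu s k ⟨h1, h2⟩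
      refine ⟨hset.2 u hu s k h1, ?_⟩
      have : v ≠ u := fun h => hl.1 (h ▸ hu)
      simp [this, h2]
    · rintro s ⟨h1, h2⟩ h3
      exact ⟨hc s h1 ⟨h2, h3⟩, by rwa [eval_nvar _ _ hlc.1]⟩

/-- If the body of nested loops establishes `P` when the loop variables have the values given by
`τ`, and never destroys it, then `P` holds in the end. -/
theorem nest_reaches {l : List ℕ} {c : ForProg} {I P : State → Prop} (τ : ℕ → ℕ) {m : ℕ}
    (hl : l.Nodup) (hlc : ∀ v ∈ l, v ∉ c.vars)
    (hm : ∀ s, I s → s.nvar 1 = m) (hτ : ∀ v ∈ l, τ v < m)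
    (hIset : ∀ v ∈ l, ∀ s k, I s → I (s.setVar v k))
    (hI : ∀ s, I s → (∀ v ∈ l, s.nvar v < m) → I (c.eval s))
    (hPset : ∀ v ∈ l, ∀ s k, P s → P (s.setVar v k))
    (hP : ∀ s, I s → P s → (∀ v ∈ l, s.nvar v < m) → P (c.eval s))
    (h : ∀ s, I s → (∀ v ∈ l, s.nvar v = τ v) → P (c.eval s)) {s : State} (hs : I s) :
    P ((nest l c).eval s) := by
  induction l generalizing I s with
  | nil => exact h s hs (by simp)
  | cons v l ih =>
    rw [List.nodup_cons] at hl
    simp only [List.mem_cons, forall_eq_or_imp] at hlc hτ hIset hPset hI hP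
    have hvset : ∀ u ∈ l, ∀ (s : State) (k : ℕ), (s.setVar u k).nvar v = s.nvar v := by
      intro u hu s k
      have : v ≠ u := fun h => hl.1 (h ▸ hu)
      simp [this]
    -- `P` is claimed only once round `τ v` is over; that round establishes it by induction on the
    -- list, and later rounds keep it.
    have key : s.nvar 1 = m ∧ (fun k s => I s ∧ (τ v < k → P s)) (s.nvar 1)
        ((count v (nest l c)).eval s) := by
      refine ⟨hm s hs, ?_⟩
      refine count_induction (fun k s => I s ∧ (τ v < k → P s)) ⟨hIset.1 _ _ hs, by simp⟩ ?_
      rintro k hk s' hs' - - - ⟨hI', hP'⟩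
      rw [hm s hs] at hk
      refine ⟨hIset.1 _ _ ?_, fun hτk => hPset.1 _ _ ?_⟩
      · exact (nest_preserves (P := fun s => I s ∧ s.nvar v < m) (l := l) (c := c) hl.2 hlc.2
          (fun s h => hm s h.1)
          (fun u hu s k h => ⟨hIset.2 u hu s k h.1, by rw [hvset u hu]; exact h.2⟩)
          (fun s h1 h2 => ⟨hI s h1.1 ⟨h1.2, h2⟩, by rw [eval_nvar _ _ hlc.1]; exact h1.2⟩)
          ⟨hI', by omega⟩).1
      rcases Nat.lt_succ_iff_lt_or_eq.1 hτk with hlt | heq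
      · exact (nest_preserves (P := fun s => I s ∧ P s ∧ s.nvar v < m) (l := l) (c := c) hl.2
          hlc.2 (fun s h => hm s h.1)
          (fun u hu s k h => ⟨hIset.2 u hu s k h.1, hPset.2 u hu s k h.2.1,
            by rw [hvset u hu]; exact h.2.2⟩)
          (fun s h1 h2 => ⟨hI s h1.1 ⟨h1.2.2, h2⟩, hP s h1.1 h1.2.1 ⟨h1.2.2, h2⟩,
            by rw [eval_nvar _ _ hlc.1]; exact h1.2.2⟩)
          ⟨hI', hP' hlt, by omega⟩).2.1
      · refine ih (I := fun s => I s ∧ s.nvar v = τ v) hl.2 hlc.2 (fun s h => hm s h.1) hτ.2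
          ?_ ?_ hPset.2 ?_ ?_ ⟨hI', hs'.trans heq.symm⟩
        · rintro u hu s k ⟨h1, h2⟩
          exact ⟨hIset.2 u hu s k h1, by rw [hvset u hu, h2]⟩
        · rintro s ⟨h1, h2⟩ h3
          exact ⟨hI s h1 ⟨by rw [h2]; exact hτ.1, h3⟩, by rw [eval_nvar _ _ hlc.1, h2]⟩
        · rintro s ⟨h1, h2⟩ h3 h4
          exact hP s h1 h3 ⟨by rw [h2]; exact hτ.1, h4⟩
        · rintro s ⟨h1, h2⟩ h3
          exact h s h1 (by simpa [h2] using h3)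
    exact key.2.2 (by rw [key.1]; exact hτ.1)

end ForProg

end RealRAM

/-! ## Sweeping over two rows

The positions `0, …, N - 1` are divided into the rows `0` and `1` by `row`.  A sweep state
`σ` at position `q`, for a set `S` of positions, holds for each row `r` the last position of `S`
before `q` in the cell `r` and the next position of `S` from `q` on in the cell `2 + r`. -/

namespace Sweep

/-- Leave the selected position `q`, with `c` as the next selected position in its row. -/
def advance (row : ℕ → ℕ) (q c : ℕ) (σ : ℕ → ℕ) : ℕ → ℕ :=
  Function.update (Function.update σ (row q) q) (2 + row q) c

/-- The minimum of `b` and the values of `f` below an argument. -/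
def minBelow (b : ℕ) (f : ℕ → ℕ) : ℕ → ℕ
  | 0 => b
  | k + 1 => if f k < minBelow b f k then f k else minBelow b f k

/-- An argument at which the minimum is attained, if it is less than `b`. -/
def argBelow (b : ℕ) (f : ℕ → ℕ) : ℕ → ℕ
  | 0 => 0
  | k + 1 => if f k < minBelow b f k then k else argBelow b f k

/-! ### The capped minimum -/

theorem minBelow_le (b : ℕ) (f : ℕ → ℕ) {c k : ℕ} (h : c < k) : minBelow b f k ≤ f c := by
  induction k with
  | zero => omega
  | succ k ih =>
    rw [minBelow]
    rcases Nat.lt_succ_iff_lt_or_eq.1 h with h | rfl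
    · have := ih h
      split_ifs <;> omega
    · split_ifs <;> omega

theorem argBelow_lt (b : ℕ) (f : ℕ → ℕ) {k : ℕ} (hk : 0 < k) : argBelow b f k < k := by
  induction k with
  | zero => omega
  | succ k ih =>
    rw [argBelow]
    split_ifs with h
    · omega
    · rcases Nat.eq_zero_or_pos k with rfl | hk
      · simp [argBelow]
      · exact (ih hk).trans (Nat.lt_succ_self k)

theorem below_congr (b : ℕ) {f g : ℕ → ℕ} {k : ℕ} (h : ∀ c < k, f c = g c) :
    minBelow b f k = minBelow b g k ∧ argBelow b f k = argBelow b g k := by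
  induction k with
  | zero => exact ⟨rfl, rfl⟩
  | succ k ih =>
    have ih := ih fun c hc => h c (by omega)
    simp only [minBelow, argBelow, ih, h k (by omega), and_self]

theorem argBelow_spec {b : ℕ} {f : ℕ → ℕ} {k : ℕ} (h : minBelow b f k < b) :
    argBelow b f k < k ∧ f (argBelow b f k) = minBelow b f k := by
  induction k with
  | zero => exact absurd h (lt_irrefl _)
  | succ k ih =>
    rw [minBelow] at h ⊢
    rw [argBelow]
    split_ifs at h ⊢ with hk
    · exact ⟨Nat.lt_succ_self k, rfl⟩
    · exact ⟨(ih h).1.trans (Nat.lt_succ_self k), (ih h).2⟩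

open Classical in
/-- The least number of positions that can be selected among the last `k` ones, starting from the
sweep state `σ`, such that `ok q σ'` holds at each position `q` that is not selected and is
reached in state `σ'`; a number above `N` if this is impossible. -/
noncomputable def value (N : ℕ) (row : ℕ → ℕ) (ok : ℕ → (ℕ → ℕ) → Prop) : ℕ → (ℕ → ℕ) → ℕ
  | 0, σ => if σ 2 = N ∧ σ 3 = N then 0 else N + 1
  | k + 1, σ =>
    if σ (2 + row (N - (k + 1))) = N - (k + 1) then
      minBelow (N + 1) (fun c => value N row ok k (advance row (N - (k + 1)) c σ)) (N + 1) + 1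
    else if ok (N - (k + 1)) σ then value N row ok k σ else N + 1

/-- The sweep state at a position when the next positions are chosen optimally. -/
noncomputable def optimal (N : ℕ) (row : ℕ → ℕ) (ok : ℕ → (ℕ → ℕ) → Prop) (σ : ℕ → ℕ) :
    ℕ → ℕ → ℕ
  | 0 => σ
  | q + 1 =>
    if optimal N row ok σ q (2 + row q) = q then
      advance row q (argBelow (N + 1) (fun c => value N row ok (N - (q + 1))
        (advance row q c (optimal N row ok σ q))) (N + 1)) (optimal N row ok σ q)
    else optimal N row ok σ q

/-- The last position of `S` before a position in row `r`; `0` if there is none. -/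
def last (row : ℕ → ℕ) (S : Finset ℕ) (r : ℕ) : ℕ → ℕ
  | 0 => 0
  | q + 1 => if q ∈ S ∧ row q = r then q else last row S r q

/-- The first position of `S` among the last `k` positions in row `r`; `N` if there is none. -/
def next (N : ℕ) (row : ℕ → ℕ) (S : Finset ℕ) (r : ℕ) : ℕ → ℕ
  | 0 => N
  | k + 1 => if N - (k + 1) ∈ S ∧ row (N - (k + 1)) = r then N - (k + 1) else next N row S r k

/-- The sweep state of the set `S` at position `q`. -/
def stateOf (N : ℕ) (row : ℕ → ℕ) (S : Finset ℕ) (q i : ℕ) : ℕ :=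
  if i < 2 then last row S i q else next N row S (i - 2) (N - q)

/-! ### The recursion computes the minimum -/

section

variable {N : ℕ} {row : ℕ → ℕ} {ok : ℕ → (ℕ → ℕ) → Prop}

theorem advance_congr {σ τ : ℕ → ℕ} (h : ∀ i < 4, σ i = τ i) (q c : ℕ) :
    ∀ i < 4, advance row q c σ i = advance row q c τ i := by
  intro i hi
  simp only [advance, Function.update_apply, h i hi]

/-- Sweep states are functions on all of `ℕ`, so that an array of the machine can serve as one, but
only four cells carry meaning. -/
theorem value_congr (hrow : ∀ q, row q < 2)
    (hok : ∀ q σ τ, (∀ i < 4, σ i = τ i) → (ok q σ ↔ ok q τ)) (k : ℕ) :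
    ∀ {σ τ : ℕ → ℕ}, (∀ i < 4, σ i = τ i) → value N row ok k σ = value N row ok k τ := by
  induction k with
  | zero =>
    intro σ τ h
    simp only [value, h 2 (by omega), h 3 (by omega)]
  | succ k ih =>
    intro σ τ h
    classical
    have hr := hrow (N - (k + 1))
    have hf : (fun c => value N row ok k (advance row (N - (k + 1)) c σ)) =
        fun c => value N row ok k (advance row (N - (k + 1)) c τ) :=
      funext fun c => ih (advance_congr h (N - (k + 1)) c)
    rw [value, value, h _ (show 2 + row (N - (k + 1)) < 4 by omega), hf, ih h]
    exact if_congr Iff.rfl rfl (if_congr (hok _ _ _ h) rfl rfl)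

theorem last_mem {S : Finset ℕ} {r q : ℕ} (h : last row S r q ≠ 0) :
    last row S r q ∈ S ∧ last row S r q < q ∧ row (last row S r q) = r := by
  induction q with
  | zero => exact absurd rfl h
  | succ q ih =>
    rw [last] at h ⊢
    split_ifs at h ⊢ with hq
    · exact ⟨hq.1, Nat.lt_succ_self q, hq.2⟩
    · have := ih h
      exact ⟨this.1, by omega, this.2.2⟩

theorem le_last {S : Finset ℕ} {r q j : ℕ} (hj : j ∈ S) (hjq : j < q) (hr : row j = r) :
    j ≤ last row S r q := by
  induction q with
  | zero => omega
  | succ q ih =>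
    rw [last]
    split_ifs with hq
    · omega
    · rcases Nat.lt_succ_iff_lt_or_eq.1 hjq with h | rfl
      · exact ih h
      · exact absurd ⟨hj, hr⟩ hq

theorem next_mem {S : Finset ℕ} {r k : ℕ} (hk : k ≤ N) (h : next N row S r k ≠ N) :
    next N row S r k ∈ S ∧ N - k ≤ next N row S r k ∧ next N row S r k < N ∧
      row (next N row S r k) = r := by
  induction k with
  | zero => exact absurd rfl h
  | succ k ih =>
    rw [next] at h ⊢
    split_ifs at h ⊢ with hq
    · exact ⟨hq.1, le_rfl, by omega, hq.2⟩
    · have := ih (by omega) h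
      exact ⟨this.1, by omega, this.2.2⟩

theorem next_le {S : Finset ℕ} {r k j : ℕ} (hj : j ∈ S) (hjk : N - k ≤ j) (hjN : j < N)
    (hr : row j = r) : next N row S r k ≤ j := by
  induction k with
  | zero => omega
  | succ k ih =>
    rw [next]
    split_ifs with hq
    · omega
    · rcases Nat.lt_or_ge j (N - k) with h | h
      · obtain rfl : j = N - (k + 1) := by omega
        exact absurd ⟨hj, hr⟩ hq
      · exact ih h

theorem le_next (S : Finset ℕ) (r k : ℕ) : N - k ≤ next N row S r k := by
  induction k with
  | zero => simp [next]
  | succ k ih =>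
    rw [next]
    split_ifs <;> omega

theorem next_le_self (S : Finset ℕ) (r k : ℕ) : next N row S r k ≤ N := by
  induction k with
  | zero => simp [next]
  | succ k ih =>
    rw [next]
    split_ifs <;> omega

theorem next_of_lt {S : Finset ℕ} {r q : ℕ} (hq : q < N) :
    next N row S r (N - q) =
      if q ∈ S ∧ row q = r then q else next N row S r (N - (q + 1)) := by
  obtain ⟨k, hk⟩ : ∃ k, N - q = k + 1 := ⟨N - q - 1, by omega⟩
  have h1 : N - (k + 1) = q := by omega
  have h2 : N - (q + 1) = k := by omega
  rw [hk, next, h1, h2]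

/-- "Next" includes the present position, so membership can be read off the sweep state. This is the
test by which `value` recognises a selected position. -/
theorem stateOf_row {S : Finset ℕ} {q : ℕ} (hq : q < N) :
    stateOf N row S q (2 + row q) = q ↔ q ∈ S := by
  have h1 : ¬ 2 + row q < 2 := by omega
  rw [stateOf, if_neg h1, Nat.add_sub_cancel_left, next_of_lt hq]
  have := le_next (N := N) (row := row) S (row q) (N - (q + 1))
  split_ifs with h
  · simp [h.1]
  · simp only [and_true] at h
    simp only [h, iff_false]
    omega

theorem stateOf_succ_of_notMem {S : Finset ℕ} {q : ℕ} (hq : q < N) (hS : q ∉ S) (i : ℕ) :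
    stateOf N row S (q + 1) i = stateOf N row S q i := by
  simp [stateOf, next_of_lt hq, last, hS]

theorem stateOf_succ_of_mem (hrow : ∀ q, row q < 2) {S : Finset ℕ} {q : ℕ} (hq : q < N)
    (hS : q ∈ S) :
    ∀ i < 4, stateOf N row S (q + 1) i =
      advance row q (next N row S (row q) (N - (q + 1))) (stateOf N row S q) i := by
  intro i hi
  have hr := hrow q
  simp only [stateOf, next_of_lt hq, last, hS, true_and, advance, Function.update_apply]
  by_cases h1 : i < 2
  · have h2 : ¬ i = 2 + row q := by omega
    simp only [h1, if_true, h2, if_false, eq_comm]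
  · have h3 : ¬ i = row q := by omega
    by_cases h2 : i = 2 + row q
    · rw [if_neg h1, if_pos h2, h2, Nat.add_sub_cancel_left]
    · have h4 : ¬ row q = i - 2 := by omega
      simp [h1, h2, h3, h4]

/-- The value of the sweep state of a suitable set is at most the size of the set. -/
theorem value_stateOf_le (hrow : ∀ q, row q < 2)
    (hok : ∀ q σ τ, (∀ i < 4, σ i = τ i) → (ok q σ ↔ ok q τ)) {S : Finset ℕ}
    (hS : ∀ q < N, q ∉ S → ok q (stateOf N row S q)) {k : ℕ} (hk : k ≤ N) :
    value N row ok k (stateOf N row S (N - k)) ≤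
      ((Finset.range N).filter fun j => j ∈ S ∧ N - k ≤ j).card := by
  induction k with
  | zero => simp [value, stateOf, next]
  | succ k ih =>
    have ih := ih (by omega)
    obtain ⟨q, hq⟩ : ∃ q, q = N - (k + 1) := ⟨_, rfl⟩
    have hq1 : N - k = q + 1 := by omega
    have hqN : q < N := by omega
    rw [hq1] at ih
    rw [value, ← hq]
    by_cases hqS : q ∈ S
    · rw [if_pos ((stateOf_row hqN).2 hqS)]
      -- The true next position of `S` in this row, or `N` if there is none, is one of the guesses
      -- over which the minimum runs.
      have h1 := minBelow_le (N + 1) (fun c => value N row ok k (advance row q c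
        (stateOf N row S q))) (k := N + 1) (Nat.lt_succ_of_le
          (next_le_self (N := N) (row := row) S (row q) (N - (q + 1))))
      have h2 := value_congr (N := N) hrow hok k (stateOf_succ_of_mem hrow hqN hqS)
      have h3 : ((Finset.range N).filter fun j => j ∈ S ∧ q ≤ j) =
          insert q ((Finset.range N).filter fun j => j ∈ S ∧ q + 1 ≤ j) := by
        ext j
        simp only [Finset.mem_filter, Finset.mem_range, Finset.mem_insert]
        constructor
        · rintro ⟨h1, h2, h3⟩
          rcases h3.eq_or_lt with h | h
          · exact Or.inl h.symm
          · exact Or.inr ⟨h1, h2, h⟩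
        · rintro (rfl | ⟨h1, h2, h3⟩)
          · exact ⟨hqN, hqS, le_rfl⟩
          · exact ⟨h1, h2, by omega⟩
      rw [h3, Finset.card_insert_of_notMem (by simp)]
      omega
    · rw [if_neg (fun h => hqS ((stateOf_row hqN).1 h)), if_pos (hS q hqN hqS),
        ← value_congr (N := N) hrow hok k fun i _ => stateOf_succ_of_notMem hqN hqS i]
      refine ih.trans (Finset.card_le_card fun j => ?_)
      simp only [Finset.mem_filter, Finset.mem_range]
      rintro ⟨h1, h2, h3⟩
      exact ⟨h1, h2, by omega⟩

/-- The set that is selected by optimal choices from the sweep state `σ` on. -/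
noncomputable def selected (N : ℕ) (row : ℕ → ℕ) (ok : ℕ → (ℕ → ℕ) → Prop) (σ : ℕ → ℕ) :
    Finset ℕ :=
  (Finset.range N).filter fun q => optimal N row ok σ q (2 + row q) = q

theorem mem_selected {σ : ℕ → ℕ} {q : ℕ} :
    q ∈ selected N row ok σ ↔ q < N ∧ optimal N row ok σ q (2 + row q) = q := by
  simp [selected]

/-- Along optimal choices, each selected position lowers the remaining value by one and each other
one keeps it. As the total is at most `N`, no failing branch is ever taken, so `ok` holds wherever
it is tested. -/
theorem value_optimal {σ : ℕ → ℕ} (hσ : value N row ok N σ ≤ N) {q : ℕ} (hq : q ≤ N) :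
    value N row ok (N - q) (optimal N row ok σ q) +
      ((selected N row ok σ).filter (· < q)).card = value N row ok N σ ∧
    ∀ j < q, j ∉ selected N row ok σ → ok j (optimal N row ok σ j) := by
  induction q with
  | zero => simp [optimal]
  | succ q ih =>
    obtain ⟨ih, ihok⟩ := ih (by omega)
    have hqN : q < N := by omega
    obtain ⟨k, hk⟩ : ∃ k, N - q = k + 1 := ⟨N - q - 1, by omega⟩
    have h1 : N - (k + 1) = q := by omega
    have h2 : N - (q + 1) = k := by omega
    rw [hk, value, h1] at ih
    rw [h2, optimal, h2]
    by_cases hs : optimal N row ok σ q (2 + row q) = q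
    · rw [if_pos hs] at ih ⊢
      have hqS : q ∈ selected N row ok σ := mem_selected.2 ⟨hqN, hs⟩
      have h3 : (selected N row ok σ).filter (· < q + 1) =
          insert q ((selected N row ok σ).filter (· < q)) := by
        ext j
        simp only [Finset.mem_filter, Finset.mem_insert]
        constructor
        · rintro ⟨h1, h2⟩
          rcases Nat.lt_succ_iff_lt_or_eq.1 h2 with h | h
          · exact Or.inr ⟨h1, h⟩
          · exact Or.inl h
        · rintro (rfl | ⟨h1, h2⟩)
          · exact ⟨hqS, Nat.lt_succ_self _⟩
          · exact ⟨h1, by omega⟩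
      -- The minimum is below the cap `N + 1` because the total value is at most `N`, so it is
      -- attained.
      have h4 := argBelow_spec (b := N + 1) (k := N + 1)
        (f := fun c => value N row ok k (advance row q c (optimal N row ok σ q))) (by omega)
      refine ⟨?_, ?_⟩
      · rw [h3, Finset.card_insert_of_notMem (by simp)]
        have h5 := h4.2
        omega
      · intro j hj hjS
        refine ihok j ?_ hjS
        have : j ≠ q := fun h => hjS (h ▸ hqS)
        omega
    · rw [if_neg hs] at ih ⊢
      have hqS : q ∉ selected N row ok σ := fun h => hs (mem_selected.1 h).2
      have h3 : (selected N row ok σ).filter (· < q + 1) =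
          (selected N row ok σ).filter (· < q) := by
        refine Finset.filter_congr fun j hj => ?_
        have : j ≠ q := fun h => hqS (h ▸ hj)
        omega
      rw [h3]
      split_ifs at ih with hokq
      · refine ⟨ih, fun j hj hjS => ?_⟩
        rcases Nat.lt_succ_iff_lt_or_eq.1 hj with h | rfl
        · exact ihok j h hjS
        · exact hokq
      · omega

/-- The guesses are right. The "last" cells agree by forward induction from the start. The "next"
cells agree by backward induction from the end: a guess changes only when it is met, so the correct
final guesses determine all earlier ones. -/
theorem optimal_eq_stateOf (hrow : ∀ q, row q < 2) {σ : ℕ → ℕ} (hσ : value N row ok N σ ≤ N)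
    (h0 : σ 0 = 0) (h1 : σ 1 = 0) {q : ℕ} (hq : q ≤ N) :
    ∀ i < 4, optimal N row ok σ q i = stateOf N row (selected N row ok σ) q i := by
  have hlast : ∀ r < 2, ∀ q ≤ N,
      optimal N row ok σ q r = last row (selected N row ok σ) r q := by
    intro r hr q
    induction q with
    | zero =>
      intro _
      obtain rfl | rfl : r = 0 ∨ r = 1 := by omega
      · exact h0
      · exact h1
    | succ q ih =>
      intro hq
      have ih := ih (by omega)
      rw [optimal, last]
      have hr' := hrow q
      have hm : q ∈ selected N row ok σ ↔ optimal N row ok σ q (2 + row q) = q := by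
        rw [mem_selected, and_iff_right (by omega)]
      by_cases hs : optimal N row ok σ q (2 + row q) = q
      · rw [if_pos hs]
        have h2 : ¬ r = 2 + row q := by omega
        simp only [advance, Function.update_apply, if_neg h2, hm, hs, true_and, ih]
        exact if_congr eq_comm rfl rfl
      · rw [if_neg hs, if_neg (by simp [hm, hs]), ih]
  have hnext : ∀ r < 2, ∀ k ≤ N,
      optimal N row ok σ (N - k) (2 + r) = next N row (selected N row ok σ) r k := by
    intro r hr k
    induction k with
    | zero =>
      intro _
      -- At the end the value is `0` or `N + 1`, and the total bound `N` excludes the latter; so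
      -- both guesses are `N`.
      have := (value_optimal hσ le_rfl).1
      rw [Nat.sub_self, value] at this
      rw [Nat.sub_zero, next]
      split_ifs at this with h
      · obtain rfl | rfl : r = 0 ∨ r = 1 := by omega
        · exact h.1
        · exact h.2
      · omega
    | succ k ih =>
      intro hk
      have ih := ih (by omega)
      rw [next, ← ih]
      obtain ⟨q, hq⟩ : ∃ q, q = N - (k + 1) := ⟨_, rfl⟩
      have hq1 : N - k = q + 1 := by omega
      rw [← hq, hq1, optimal]
      have hm : q ∈ selected N row ok σ ↔ optimal N row ok σ q (2 + row q) = q := by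
        rw [mem_selected, and_iff_right (by omega)]
      have hr' := hrow q
      by_cases hs : optimal N row ok σ q (2 + row q) = q
      · by_cases hqr : row q = r
        · rw [if_pos ⟨hm.2 hs, hqr⟩, ← hqr, hs]
        · have h2 : ¬ 2 + r = 2 + row q := by omega
          have h3 : ¬ 2 + r = row q := by omega
          rw [if_neg (fun h => hqr h.2), if_pos hs]
          simp only [advance, Function.update_apply, if_neg h2, if_neg h3]
      · rw [if_neg (by simp [hm, hs]), if_neg hs]
  intro i hi
  rw [stateOf]
  split_ifs with h
  · exact hlast i h q hq
  · obtain ⟨r, rfl⟩ : ∃ r, i = 2 + r := ⟨i - 2, by omega⟩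
    rw [Nat.add_sub_cancel_left, ← hnext r (by omega) (N - q) (by omega),
      Nat.sub_sub_self hq]

/-- The dummy positions `0` and `1` come first in their rows, so all sets containing them share one
initial sweep state. -/
theorem stateOf_zero {T : Finset ℕ} (hN : 2 ≤ N) (hrow0 : row 0 = 0) (hrow1 : row 1 = 1)
    (hT0 : 0 ∈ T) (hT1 : 1 ∈ T) {σ : ℕ → ℕ} (h0 : σ 0 = 0) (h1 : σ 1 = 0) (h2 : σ 2 = 0)
    (h3 : σ 3 = 1) : ∀ i < 4, stateOf N row T 0 i = σ i := by
  intro i hi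
  have hn0 : next N row T 0 (N - 0) = 0 := by rw [next_of_lt (by omega), if_pos ⟨hT0, hrow0⟩]
  have hn1 : next N row T 1 (N - 0) = 1 := by
    rw [next_of_lt (by omega), if_neg (by simp [hrow0]), next_of_lt (by omega),
      if_pos ⟨hT1, hrow1⟩]
  obtain rfl | rfl | rfl | rfl : i = 0 ∨ i = 1 ∨ i = 2 ∨ i = 3 := by omega
  · simp [stateOf, last, h0]
  · simp [stateOf, last, h1]
  · simpa [stateOf, h2] using hn0
  · simpa [stateOf, h3] using hn1

/-- The selected set is a smallest one among the sets that contain `0` and `1` and satisfy the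
condition at each position outside of them. -/
theorem selected_minimal (hN : 2 ≤ N) (hrow : ∀ q, row q < 2) (hrow0 : row 0 = 0)
    (hrow1 : row 1 = 1) (hok : ∀ q σ τ, (∀ i < 4, σ i = τ i) → (ok q σ ↔ ok q τ)) {σ : ℕ → ℕ}
    (h0 : σ 0 = 0) (h1 : σ 1 = 0) (h2 : σ 2 = 0) (h3 : σ 3 = 1) :
    0 ∈ selected N row ok σ ∧ 1 ∈ selected N row ok σ ∧
    (∀ q < N, q ∉ selected N row ok σ → ok q (stateOf N row (selected N row ok σ) q)) ∧
    ∀ T ⊆ Finset.range N, 0 ∈ T → 1 ∈ T → (∀ q < N, q ∉ T → ok q (stateOf N row T q)) →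
      (selected N row ok σ).card ≤ T.card := by
  have key : ∀ T ⊆ Finset.range N, 0 ∈ T → 1 ∈ T →
      (∀ q < N, q ∉ T → ok q (stateOf N row T q)) → value N row ok N σ ≤ T.card := by
    intro T hTN hT0 hT1 hT
    rw [← value_congr hrow hok N (stateOf_zero hN hrow0 hrow1 hT0 hT1 h0 h1 h2 h3)]
    have := value_stateOf_le hrow hok hT le_rfl
    rw [Nat.sub_self] at this
    refine this.trans (Finset.card_le_card fun j hj => ?_)
    exact (Finset.mem_filter.1 hj).2.1
  -- Selecting everything is admissible, as no position is left to be tested.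
  have hσ : value N row ok N σ ≤ N := by
    have := key (Finset.range N) le_rfl (by simp; omega) (by simp; omega) (by simp +contextual)
    rwa [Finset.card_range] at this
  have hv := value_optimal hσ le_rfl
  have hend := hv.1
  refine ⟨?_, ?_, ?_, ?_⟩
  · rw [mem_selected]
    refine ⟨by omega, ?_⟩
    simp [optimal, hrow0, h2]
  · rw [mem_selected]
    refine ⟨by omega, ?_⟩
    simp [optimal, hrow0, h2, hrow1, h3, advance]
  · intro q hq hqS
    exact (hok _ _ _ (optimal_eq_stateOf hrow hσ h0 h1 hq.le)).1 (hv.2 q hq hqS)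
  · intro T hTN hT0 hT1 hT
    refine le_trans ?_ (key T hTN hT0 hT1 hT)
    have h4 : (selected N row ok σ).filter (· < N) = selected N row ok σ :=
      Finset.filter_true_of_mem fun j hj => (mem_selected.1 hj).1
    rw [h4] at hend
    omega

end

/-! ### Nearest selected positions -/

/-- The condition on a point at position `q`, read off from its at most four candidates for a
closest point in the sweep state; positions below `2` and from `N` on do not count. -/
def CandidatesOK (N : ℕ) (d : ℕ → ℕ → ℝ) (col : ℕ → ℕ) (q : ℕ) (σ : ℕ → ℕ) : TieRule → Prop
  | .all => (∃ i < 4, 2 ≤ σ i ∧ σ i < N) ∧ ∀ i < 4, 2 ≤ σ i → σ i < N →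
      (∀ j < 4, 2 ≤ σ j → σ j < N → d q (σ i) ≤ d q (σ j)) → col (σ i) = col q
  | .some => ∃ i < 4, 2 ≤ σ i ∧ σ i < N ∧
      (∀ j < 4, 2 ≤ σ j → σ j < N → d q (σ i) ≤ d q (σ j)) ∧ col (σ i) = col q

theorem candidatesOK_congr (N : ℕ) (d : ℕ → ℕ → ℝ) (col : ℕ → ℕ) (tie : TieRule) (q : ℕ)
    (σ τ : ℕ → ℕ) (h : ∀ i < 4, σ i = τ i) :
    CandidatesOK N d col q σ tie ↔ CandidatesOK N d col q τ tie := by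
  have : ∀ σ τ : ℕ → ℕ, (∀ i < 4, σ i = τ i) → CandidatesOK N d col q σ tie →
      CandidatesOK N d col q τ tie := by
    intro σ τ h
    cases tie with
    | all =>
      rintro ⟨⟨i, hi, h1⟩, h2⟩
      refine ⟨⟨i, hi, h i hi ▸ h1⟩, fun i hi h3 h4 h5 => ?_⟩
      rw [← h i hi] at h3 h4 h5 ⊢
      refine h2 i hi h3 h4 fun j hj h6 h7 => ?_
      rw [h j hj] at h6 h7 ⊢
      exact h5 j hj h6 h7
    | some =>
      rintro ⟨i, hi, h1, h2, h3, h4⟩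
      rw [h i hi] at h1 h2 h3 h4
      refine ⟨i, hi, h1, h2, fun j hj h6 h7 => ?_, h4⟩
      rw [← h j hj] at h6 h7 ⊢
      exact h3 j hj h6 h7
  exact ⟨this σ τ h, this τ σ fun i hi => (h i hi).symm⟩

/-- Within a row, distances to a point grow with the number of positions in between. -/
def Monotone (N : ℕ) (row : ℕ → ℕ) (d : ℕ → ℕ → ℝ) : Prop :=
  ∀ i j k, 2 ≤ i → i < N → 2 ≤ j → j < N → 2 ≤ k → k < N → row j = row k →
    (j < k ∧ k < i ∨ i < k ∧ k < j) → d i k < d i j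

/-- Position `j` is a closest one to position `q` among those of `S` from `2` on. -/
def Closest (d : ℕ → ℕ → ℝ) (S : Finset ℕ) (q j : ℕ) : Prop :=
  j ∈ S ∧ 2 ≤ j ∧ ∀ k ∈ S, 2 ≤ k → d q j ≤ d q k

/-- Every selected point is one of the four candidates or strictly farther than the candidate on its
side in its row. Strictness means that ties cannot hide a closest point, so both tie rules can be
tested on the candidates. The bounds `2` and `N` discard the dummies and the default values of
`last` and `next`. As `q ∉ S`, the "next" positions lie strictly after `q`. -/
theorem closest_iff {N : ℕ} {row : ℕ → ℕ} (hrow : ∀ q, row q < 2) {d : ℕ → ℕ → ℝ}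
    (hd : Monotone N row d) {S : Finset ℕ} (hS : S ⊆ Finset.range N) {q : ℕ} (hq2 : 2 ≤ q)
    (hqN : q < N) (hqS : q ∉ S) (j : ℕ) :
    Closest d S q j ↔ ∃ i < 4, stateOf N row S q i = j ∧ 2 ≤ j ∧ j < N ∧
      ∀ i' < 4, 2 ≤ stateOf N row S q i' → stateOf N row S q i' < N →
        d q j ≤ d q (stateOf N row S q i') := by
  have hmem : ∀ i < 4, 2 ≤ stateOf N row S q i → stateOf N row S q i < N →
      stateOf N row S q i ∈ S := by
    intro i hi h1 h2
    unfold stateOf at h1 h2 ⊢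
    split_ifs at h1 h2 ⊢ with h
    · exact (last_mem (by omega)).1
    · exact (next_mem (by omega) (by omega)).1
  have hbest : ∀ k ∈ S, 2 ≤ k → ∃ i < 4, 2 ≤ stateOf N row S q i ∧ stateOf N row S q i < N ∧
      (stateOf N row S q i = k ∨ d q (stateOf N row S q i) < d q k) := by
    intro k hk hk2
    have hkN := Finset.mem_range.1 (hS hk)
    have hr := hrow k
    have hkq : k ≠ q := fun h => hqS (h ▸ hk)
    rcases Nat.lt_or_gt_of_ne hkq with h | h
    · have h1 := le_last (row := row) hk h rfl
      have h2 := last_mem (row := row) (S := S) (r := row k) (q := q) (by omega)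
      refine ⟨row k, by omega, ?_⟩
      rw [stateOf, if_pos hr]
      refine ⟨by omega, by omega, ?_⟩
      rcases h1.eq_or_lt with h3 | h3
      · exact Or.inl h3.symm
      · exact Or.inr (hd q k _ hq2 hqN hk2 hkN (by omega) (by omega) h2.2.2.symm
          (Or.inl ⟨h3, h2.2.1⟩))
    · have h1 := next_le (N := N) (row := row) (r := row k) (k := N - q) hk (by omega) hkN rfl
      have h2 := next_mem (N := N) (row := row) (S := S) (r := row k) (k := N - q) (by omega)
        (by omega)
      have h5 : next N row S (row k) (N - q) ≠ q := fun h => hqS (h ▸ h2.1)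
      refine ⟨2 + row k, by omega, ?_⟩
      rw [stateOf, if_neg (by omega), Nat.add_sub_cancel_left]
      refine ⟨by omega, by omega, ?_⟩
      rcases h1.eq_or_lt with h3 | h3
      · exact Or.inl h3
      · exact Or.inr (hd q k _ hq2 hqN hk2 hkN (by omega) (by omega) h2.2.2.2.symm
          (Or.inr ⟨by omega, h3⟩))
  constructor
  · rintro ⟨h1, h2, h3⟩
    obtain ⟨i, hi, h4, h5, h6⟩ := hbest j h1 h2
    refine ⟨i, hi, ?_, h2, Finset.mem_range.1 (hS h1), fun i' hi' h7 h8 =>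
      h3 _ (hmem i' hi' h7 h8) h7⟩
    rcases h6 with h6 | h6
    · exact h6
    · exact absurd (h3 _ (hmem i hi h4 h5) h4) (not_le.2 h6)
  · rintro ⟨i, hi, rfl, h2, h3, h4⟩
    refine ⟨hmem i hi h2 h3, h2, fun k hk hk2 => ?_⟩
    obtain ⟨i', hi', h5, h6, h7⟩ := hbest k hk hk2
    rcases h7 with h7 | h7
    · exact h7 ▸ h4 i' hi' h5 h6
    · exact (h4 i' hi' h5 h6).trans h7.le

theorem candidatesOK_some_iff {N : ℕ} {row : ℕ → ℕ} (hrow : ∀ q, row q < 2) {d : ℕ → ℕ → ℝ}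
    (hd : Monotone N row d) {S : Finset ℕ} (hS : S ⊆ Finset.range N) {q : ℕ} (hq2 : 2 ≤ q)
    (hqN : q < N) (hqS : q ∉ S) (col : ℕ → ℕ) :
    CandidatesOK N d col q (stateOf N row S q) .some ↔
      ∃ j, Closest d S q j ∧ col j = col q := by
  simp only [closest_iff hrow hd hS hq2 hqN hqS, CandidatesOK]
  constructor
  · rintro ⟨i, hi, h1, h2, h3, h4⟩
    exact ⟨_, ⟨i, hi, rfl, h1, h2, h3⟩, h4⟩
  · rintro ⟨_, ⟨i, hi, rfl, h1, h2, h3⟩, h4⟩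
    exact ⟨i, hi, h1, h2, h3, h4⟩

theorem candidatesOK_all_iff {N : ℕ} {row : ℕ → ℕ} (hrow : ∀ q, row q < 2) {d : ℕ → ℕ → ℝ}
    (hd : Monotone N row d) {S : Finset ℕ} (hS : S ⊆ Finset.range N) {q : ℕ} (hq2 : 2 ≤ q)
    (hqN : q < N) (hqS : q ∉ S) (col : ℕ → ℕ) :
    CandidatesOK N d col q (stateOf N row S q) .all ↔
      (∃ j, Closest d S q j) ∧ ∀ j, Closest d S q j → col j = col q := by
  refine and_congr ?_ ?_
  · constructor
    · rintro ⟨i, hi, h1, h2⟩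
      -- A nearest one among the finitely many valid candidates is a closest selected point.
      obtain ⟨j, hj, hmin⟩ := Finset.exists_min_image
        ((Finset.range 4).filter fun i => 2 ≤ stateOf N row S q i ∧ stateOf N row S q i < N)
        (fun i => d q (stateOf N row S q i)) ⟨i, by simp [hi, h1, h2]⟩
      simp only [Finset.mem_filter, Finset.mem_range] at hj hmin
      exact ⟨_, (closest_iff hrow hd hS hq2 hqN hqS _).2 ⟨j, hj.1, rfl, hj.2.1, hj.2.2,
        fun i' hi' h1 h2 => hmin i' ⟨hi', h1, h2⟩⟩⟩
    · rintro ⟨j, hj⟩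
      obtain ⟨i, hi, rfl, h1, h2, -⟩ := (closest_iff hrow hd hS hq2 hqN hqS j).1 hj
      exact ⟨i, hi, h1, h2⟩
  · simp only [closest_iff hrow hd hS hq2 hqN hqS]
    constructor
    · rintro h _ ⟨i, hi, rfl, h1, h2, h3⟩
      exact h i hi h1 h2 h3
    · intro h i hi h1 h2 h3
      exact h _ ⟨i, hi, rfl, h1, h2, h3⟩

end Sweep

namespace RealRAM

/-! ## The program -/

namespace Test

/-- Disjunction of two tests. -/
def either (b₁ b₂ : Test) : Test := .neg (.both (.neg b₁) (.neg b₂))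

/-- Implication between two tests. -/
def implies (b₁ b₂ : Test) : Test := .neg (.both b₁ (.neg b₂))

/-- Conjunction of the tests `b 0, …, b (k - 1)`. -/
def all (b : ℕ → Test) : ℕ → Test
  | 0 => .neq (.const 0) (.const 0)
  | k + 1 => .both (all b k) (b k)

/-- Disjunction of the tests `b 0, …, b (k - 1)`. -/
def any (b : ℕ → Test) (k : ℕ) : Test := .neg (all (fun i => .neg (b i)) k)

@[simp] theorem holds_either (s : State) (b₁ b₂ : Test) :
    (either b₁ b₂).Holds s ↔ b₁.Holds s ∨ b₂.Holds s := by
  simp only [either, Holds]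
  tauto

@[simp] theorem holds_implies (s : State) (b₁ b₂ : Test) :
    (implies b₁ b₂).Holds s ↔ (b₁.Holds s → b₂.Holds s) := by
  simp only [implies, Holds]
  tauto

@[simp] theorem holds_all (s : State) (b : ℕ → Test) (k : ℕ) :
    (all b k).Holds s ↔ ∀ i < k, (b i).Holds s := by
  induction k with
  | zero => simp [all, Holds]
  | succ k ih => simp only [all, Holds, ih, Nat.forall_lt_succ_right]

@[simp] theorem holds_any (s : State) (b : ℕ → Test) (k : ℕ) :
    (any b k).Holds s ↔ ∃ i < k, (b i).Holds s := by
  simp [any, Holds]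

end Test

/-- Scalar product of point `k` with the vector from point `a` to point `b`. -/
def along (P : ℕ → ℕ → ℝ) (a b k : ℕ) : ℝ :=
  (P 0 b - P 0 a) * P 0 k + (P 1 b - P 1 a) * P 1 k

/-- Cross product of the vector from point `a` to point `b` with point `k`. -/
def across (P : ℕ → ℕ → ℝ) (a b k : ℕ) : ℝ :=
  (P 0 b - P 0 a) * P 1 k - (P 1 b - P 1 a) * P 0 k

/-- Squared distance of the points `j` and `k`. -/
def sqDist (P : ℕ → ℕ → ℝ) (j k : ℕ) : ℝ :=
  (P 0 j - P 0 k) * (P 0 j - P 0 k) + (P 1 j - P 1 k) * (P 1 j - P 1 k)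

namespace RExp

/-- The expression for `RealRAM.along`. -/
def along (a b k : NExp) : RExp :=
  .add (.mul (.sub (.get 0 b) (.get 0 a)) (.get 0 k)) (.mul (.sub (.get 1 b) (.get 1 a)) (.get 1 k))

/-- The expression for `RealRAM.across`. -/
def across (a b k : NExp) : RExp :=
  .sub (.mul (.sub (.get 0 b) (.get 0 a)) (.get 1 k)) (.mul (.sub (.get 1 b) (.get 1 a)) (.get 0 k))

/-- The expression for `RealRAM.sqDist`. -/
def sqDist (j k : NExp) : RExp :=
  .add (.mul (.sub (.get 0 j) (.get 0 k)) (.sub (.get 0 j) (.get 0 k)))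
    (.mul (.sub (.get 1 j) (.get 1 k)) (.sub (.get 1 j) (.get 1 k)))

@[simp] theorem eval_along (s : State) (a b k : NExp) :
    (along a b k).eval s = RealRAM.along s.rarr (a.eval s) (b.eval s) (k.eval s) := rfl

@[simp] theorem eval_across (s : State) (a b k : NExp) :
    (across a b k).eval s = RealRAM.across s.rarr (a.eval s) (b.eval s) (k.eval s) := rfl

@[simp] theorem eval_sqDist (s : State) (j k : NExp) :
    (sqDist j k).eval s = RealRAM.sqDist s.rarr (j.eval s) (k.eval s) := rfl

end RExp

open ForProg

/-! ### Finding the direction of the lines -/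

/-- All points lie on two lines in the direction from point `a` to point `b`, one of them through
these points. -/
def IsDirection (P : ℕ → ℕ → ℝ) (n a b : ℕ) : Prop :=
  a < n ∧ b < n ∧ a ≠ b ∧ ∀ k < n, ∀ l < n, across P a b k ≠ across P a b a →
    across P a b l ≠ across P a b a → across P a b k = across P a b l

/-- Set variable `6` to `0` if there are three lines in the direction from point `2` to `3`. -/
def rejectDirection : ForProg :=
  nest [4, 5]
    (.branch
      (.both (.both (.nlt (.var 4) (.var 0)) (.nlt (.var 5) (.var 0)))
        (.both (.neg (.req (.across (.var 2) (.var 3) (.var 4))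
            (.across (.var 2) (.var 3) (.var 2))))
          (.both (.neg (.req (.across (.var 2) (.var 3) (.var 5))
              (.across (.var 2) (.var 3) (.var 2))))
            (.neg (.req (.across (.var 2) (.var 3) (.var 4))
              (.across (.var 2) (.var 3) (.var 5)))))))
      (.setN 6 (.const 0)) .skip)

/-- Find two points that give the direction of the lines, and store them in the variables `7`
and `8`. -/
def findDirection : ForProg :=
  nest [2, 3]
    (.seq (.seq (.setN 6 (.const 1)) rejectDirection)
      (.branch
        (.both (.both (.neq (.var 6) (.const 1)) (.neg (.neq (.var 2) (.var 3))))
          (.both (.nlt (.var 2) (.var 0)) (.nlt (.var 3) (.var 0))))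
        (.seq (.setN 7 (.var 2)) (.setN 8 (.var 3))) .skip))

theorem rejectDirection_spec {s : State} (hm : s.nvar 0 ≤ s.nvar 1) (h6 : s.nvar 6 = 1) :
    (rejectDirection.eval s).nvar 6 = 1 ↔ ∀ k < s.nvar 0, ∀ l < s.nvar 0,
      across s.rarr (s.nvar 2) (s.nvar 3) k ≠ across s.rarr (s.nvar 2) (s.nvar 3) (s.nvar 2) →
      across s.rarr (s.nvar 2) (s.nvar 3) l ≠ across s.rarr (s.nvar 2) (s.nvar 3) (s.nvar 2) →
      across s.rarr (s.nvar 2) (s.nvar 3) k = across s.rarr (s.nvar 2) (s.nvar 3) l := by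
  set a := s.nvar 2 with ha
  set b := s.nvar 3 with hb
  set n := s.nvar 0 with hn
  set P := s.rarr with hP
  set I : State → Prop := fun s' => s'.nvar 0 = n ∧ s'.nvar 1 = s.nvar 1 ∧ s'.nvar 2 = a ∧
    s'.nvar 3 = b ∧ s'.rarr = P with hI
  have hIset : ∀ v ∈ [4, 5], ∀ s k, I s → I (s.setVar v k) := by
    simp +contextual [hI]
  constructor
  · intro h
    by_contra! hex
    obtain ⟨k, hk, l, hl, h1, h2, h3⟩ := hex
    have : (rejectDirection.eval s).nvar 6 = 0 := by
      refine nest_reaches (I := I) (P := fun s => s.nvar 6 = 0) (m := s.nvar 1)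
        (fun v => if v = 4 then k else l) (by decide) (by decide) (fun s h => h.2.1) ?_ hIset
        ?_ ?_ ?_ ?_ ⟨rfl, rfl, rfl, rfl, rfl⟩
      · simp only [List.mem_cons, List.not_mem_nil, or_false, forall_eq_or_imp, forall_eq]
        simp only [if_true, show ¬ 5 = 4 by decide, if_false]
        omega
      · rintro s' hs' -
        rw [ForProg.eval]
        split_ifs
        · simpa [hI, ForProg.eval] using hs'
        · exact hs'
      · simp +contextual
      · rintro s' - hs' -
        rw [ForProg.eval]
        split_ifs
        · simp [ForProg.eval, NExp.eval]
        · exact hs'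
      · rintro s' ⟨g0, g1, g2, g3, g4⟩ hs'
        have g5 : s'.nvar 4 = k := by simpa using hs' 4
        have g6 : s'.nvar 5 = l := by simpa using hs' 5
        rw [ForProg.eval, if_pos]
        · simp [ForProg.eval, NExp.eval]
        · simp [Test.Holds, NExp.eval, g0, g2, g3, g4, g5, g6, hk, hl, h1, h2, h3]
    omega
  · intro h
    refine (nest_preserves (P := fun s => I s ∧ s.nvar 6 = 1) (m := s.nvar 1) (l := [4, 5])
      (by decide) (by decide) (fun s h => h.1.2.1) ?_ ?_ ⟨⟨rfl, rfl, rfl, rfl, rfl⟩, h6⟩).2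
    · intro v hv s k h
      refine ⟨hIset v hv s k h.1, ?_⟩
      revert v
      simp [h.2]
    · rintro s' ⟨⟨g0, g1, g2, g3, g4⟩, h2⟩ -
      rw [ForProg.eval, if_neg]
      · exact ⟨⟨g0, g1, g2, g3, g4⟩, h2⟩
      · simp only [Test.Holds, NExp.eval, RExp.eval_across, g0, g2, g3, g4]
        rintro ⟨⟨h3, h4⟩, h5, h6, h7⟩
        exact h7 (h _ h3 _ h4 h5 h6)

theorem findDirection_spec {s : State} (hm : s.nvar 0 ≤ s.nvar 1)
    (hex : ∃ a b, IsDirection s.rarr (s.nvar 0) a b) :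
    IsDirection s.rarr (s.nvar 0) ((findDirection.eval s).nvar 7)
      ((findDirection.eval s).nvar 8) := by
  obtain ⟨a, b, hab⟩ := hex
  set n := s.nvar 0 with hn
  set P := s.rarr with hP
  set I : State → Prop := fun s' => s'.nvar 0 = n ∧ s'.nvar 1 = s.nvar 1 ∧ s'.rarr = P with hI
  -- After the inner search, the flag and the guards together decide `IsDirection` for the present
  -- pair, and nothing the outer loops rely on has changed.
  have hbody : ∀ s' : State, I s' → ∀ s'', s'' =
      (seq (.setN 6 (.const 1)) rejectDirection).eval s' →
      I s'' ∧ s''.nvar 2 = s'.nvar 2 ∧ s''.nvar 3 = s'.nvar 3 ∧ s''.nvar 7 = s'.nvar 7 ∧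
      s''.nvar 8 = s'.nvar 8 ∧ (s''.nvar 6 = 1 ∧ ¬ s''.nvar 2 = s''.nvar 3 ∧
        s''.nvar 2 < n ∧ s''.nvar 3 < n ↔ IsDirection P n (s'.nvar 2) (s'.nvar 3)) := by
    rintro s' ⟨g0, g1, g2⟩ s'' rfl
    have e : ∀ u, u ∉ (seq (.setN 6 (.const 1)) rejectDirection).vars →
        ((seq (.setN 6 (.const 1)) rejectDirection).eval s').nvar u = s'.nvar u :=
      fun u hu => eval_nvar _ _ hu
    have hr := rejectDirection_spec (s := s'.setVar 6 1) (by simpa [g0, g1] using hm) (by simp)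
    refine ⟨⟨by rw [e 0 (by decide), g0], by rw [e 1 (by decide), g1], by rw [eval_rarr, g2]⟩,
      e 2 (by decide), e 3 (by decide), e 7 (by decide), e 8 (by decide), ?_⟩
    rw [e 2 (by decide), e 3 (by decide)]
    simp only [ForProg.eval, NExp.eval]
    rw [hr, IsDirection]
    simp only [State.setVar_nvar, State.setVar_rarr, g0, g2, reduceIte,
      show ¬ 2 = 6 by decide, show ¬ 3 = 6 by decide, show ¬ 0 = 6 by decide]
    tauto
  refine nest_reaches (I := I) (P := fun s' => IsDirection P n (s'.nvar 7) (s'.nvar 8))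
    (m := s.nvar 1) (fun v => if v = 2 then a else b) (by decide) (by decide) (fun s h => h.2.1)
    ?_ ?_ ?_ ?_ ?_ ?_ ⟨rfl, rfl, rfl⟩
  · have := hab.1
    have := hab.2.1
    simp
    omega
  · simp +contextual [hI]
  · rintro s' hs' -
    have hb := hbody s' hs' _ rfl
    rw [eval_seq, eval_branch]
    generalize (seq (.setN 6 (.const 1)) rejectDirection).eval s' = s'' at hb ⊢
    obtain ⟨⟨g0, g1, g2⟩, -⟩ := hb
    split_ifs
    · simp [hI, ForProg.eval, g0, g1, g2]
    · exact ⟨g0, g1, g2⟩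
  · simp +contextual
  · rintro s' hs' hd -
    have hb := hbody s' hs' _ rfl
    rw [eval_seq, eval_branch]
    generalize (seq (.setN 6 (.const 1)) rejectDirection).eval s' = s'' at hb ⊢
    obtain ⟨⟨g0, g1, g2⟩, h2, h3, h7, h8, h⟩ := hb
    split_ifs with ht
    · simp only [ForProg.eval, NExp.eval, State.setVar_nvar]
      simp only [Test.Holds, NExp.eval, g0] at ht
      have := h.1 ⟨ht.1.1, ht.1.2, ht.2⟩
      simpa [h2, h3] using this
    · simpa [ForProg.eval, h7, h8] using hd
  · rintro s' hs' hv
    have hb := hbody s' hs' _ rfl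
    rw [eval_seq, eval_branch]
    generalize (seq (.setN 6 (.const 1)) rejectDirection).eval s' = s'' at hb ⊢
    obtain ⟨⟨g0, g1, g2⟩, h2, h3, h7, h8, h⟩ := hb
    have e2 : s'.nvar 2 = a := by simpa using hv 2
    have e3 : s'.nvar 3 = b := by simpa using hv 3
    rw [e2, e3] at h
    have ht := h.2 hab
    rw [if_pos]
    · simp only [ForProg.eval, NExp.eval, State.setVar_nvar]
      simpa [h2, h3, e2, e3] using hab
    · simp only [Test.Holds, NExp.eval, g0]
      exact ⟨⟨ht.1, ht.2.1⟩, ht.2.2⟩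

/-! ### Sorting the points -/

/-- Point `j` precedes point `k` in the direction from point `a` to point `b`. -/
def Precedes (P : ℕ → ℕ → ℝ) (a b j k : ℕ) : Prop :=
  along P a b j < along P a b k ∨ along P a b j = along P a b k ∧ j < k

theorem precedes_iff {P : ℕ → ℕ → ℝ} {a b j k : ℕ} : Precedes P a b j k ↔
    along P a b j < along P a b k ∨ along P a b j = along P a b k ∧ j < k := Iff.rfl

open Classical in
/-- The position of point `k` in the sorted order; positions start with `2`. -/
noncomputable def position (P : ℕ → ℕ → ℝ) (n a b k : ℕ) : ℕ :=
  2 + ((Finset.range n).filter fun j => Precedes P a b j k).card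

/-- `Precedes` is a strict total order, with equal projections separated by the index, so counting
predecessors is strictly monotone. -/
theorem position_lt_iff {P : ℕ → ℕ → ℝ} {n a b j k : ℕ} (hj : j < n) (hk : k < n) :
    position P n a b j < position P n a b k ↔ Precedes P a b j k := by
  classical
  have h1 : ∀ i j k, Precedes P a b i j → Precedes P a b j k → Precedes P a b i k := by
    rintro i j k (h | ⟨h, h'⟩) (g | ⟨g, g'⟩)
    · exact Or.inl (h.trans g)
    · exact Or.inl (g ▸ h)
    · exact Or.inl (h ▸ g)
    · exact Or.inr ⟨h.trans g, h'.trans g'⟩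
  have h2 : ∀ i, ¬ Precedes P a b i i := by simp [Precedes]
  have h3 : ∀ j k, j < n → Precedes P a b j k → position P n a b j < position P n a b k := by
    intro j k hj h
    refine Nat.add_lt_add_left (Finset.card_lt_card ⟨fun i => ?_, fun hsub => ?_⟩) 2
    · simp only [Finset.mem_filter]
      exact fun hi => ⟨hi.1, h1 _ _ _ hi.2 h⟩
    · have : j ∈ (Finset.range n).filter fun i => Precedes P a b i j :=
        hsub (Finset.mem_filter.2 ⟨Finset.mem_range.2 hj, h⟩)
      exact h2 j (Finset.mem_filter.1 this).2
  refine ⟨fun h => ?_, h3 j k hj⟩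
  by_contra hn
  have : j = k ∨ Precedes P a b k j := by
    simp only [Precedes, not_or, not_and, not_lt] at hn ⊢
    rcases hn.1.eq_or_lt with h' | h'
    · rcases (hn.2 h'.symm).eq_or_lt with h'' | h''
      · exact Or.inl h''.symm
      · exact Or.inr (Or.inr ⟨h', h''⟩)
    · exact Or.inr (Or.inl h')
  rcases this with rfl | h'
  · exact lt_irrefl _ h
  · exact lt_asymm h (h3 k j hk h')

theorem position_injOn {P : ℕ → ℕ → ℝ} {n a b j k : ℕ} (hj : j < n) (hk : k < n)
    (h : position P n a b j = position P n a b k) : j = k := by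
  have h1 : ¬ Precedes P a b j k := by rw [← position_lt_iff hj hk]; omega
  have h2 : ¬ Precedes P a b k j := by rw [← position_lt_iff hk hj]; omega
  simp only [Precedes, not_or, not_and, not_lt] at h1 h2
  have h3 := le_antisymm h2.1 h1.1
  exact le_antisymm (h2.2 h3.symm) (h1.2 h3)

theorem position_lt {P : ℕ → ℕ → ℝ} {n a b k : ℕ} (hk : k < n) :
    position P n a b k < n + 2 := by
  classical
  have : ((Finset.range n).filter fun j => Precedes P a b j k).card < (Finset.range n).card := by
    refine Finset.card_lt_card ⟨Finset.filter_subset _ _, fun h => ?_⟩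
    have := (Finset.mem_filter.1 (h (Finset.mem_range.2 hk))).2
    simp [Precedes] at this
  rw [Finset.card_range] at this
  rw [position]
  omega

/-- An injection between finite sets of the same size `n` is onto. -/
theorem exists_position {P : ℕ → ℕ → ℝ} {n a b q : ℕ} (hq : 2 ≤ q) (hqn : q < n + 2) :
    ∃ k < n, position P n a b k = q := by
  have h := Finset.surj_on_of_inj_on_of_card_le (s := Finset.range n) (t := Finset.Ico 2 (n + 2))
    (fun k _ => position P n a b k)
    (fun k hk => Finset.mem_Ico.2 ⟨by simp [position], position_lt (Finset.mem_range.1 hk)⟩)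
    (fun j k hj hk h => position_injOn (Finset.mem_range.1 hj) (Finset.mem_range.1 hk) h)
    (by simp) q (Finset.mem_Ico.2 ⟨hq, hqn⟩)
  obtain ⟨k, hk, rfl⟩ := h
  exact ⟨k, Finset.mem_range.1 hk, rfl⟩

/-- Compute the position of point `2` in variable `4`. -/
def computePosition : ForProg :=
  .seq (.setN 4 (.const 2))
    (.count 3
      (.branch
        (.both (.nlt (.var 3) (.var 0))
          (.either
            (.rlt (.along (.var 7) (.var 8) (.var 3)) (.along (.var 7) (.var 8) (.var 2)))
            (.both
              (.req (.along (.var 7) (.var 8) (.var 3)) (.along (.var 7) (.var 8) (.var 2)))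
              (.nlt (.var 3) (.var 2)))))
        (.setN 4 (.add (.var 4) (.const 1))) .skip))

/-- Store the points in sorted order in array `4` and their rows in array `5`. -/
def sortPoints : ForProg :=
  .seq
    (.count 2
      (.branch (.nlt (.var 2) (.var 0))
        (.seq computePosition
          (.seq (.putN 4 (.var 4) (.var 2))
            (.branch
              (.req (.across (.var 7) (.var 8) (.var 2)) (.across (.var 7) (.var 8) (.var 7)))
              (.putN 5 (.var 4) (.const 0)) (.putN 5 (.var 4) (.const 1)))))
        .skip))
    (.putN 5 (.const 1) (.const 1))

theorem computePosition_spec {s : State} (hm : s.nvar 0 ≤ s.nvar 1) :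
    (computePosition.eval s).nvar 4 =
      position s.rarr (s.nvar 0) (s.nvar 7) (s.nvar 8) (s.nvar 2) := by
  classical
  set s1 := s.setVar 4 2 with hs1
  have h := count_induction (v := 3) (s := s1)
    (c := .branch
        (.both (.nlt (.var 3) (.var 0))
          (.either
            (.rlt (.along (.var 7) (.var 8) (.var 3)) (.along (.var 7) (.var 8) (.var 2)))
            (.both
              (.req (.along (.var 7) (.var 8) (.var 3)) (.along (.var 7) (.var 8) (.var 2)))
              (.nlt (.var 3) (.var 2)))))
        (.setN 4 (.add (.var 4) (.const 1))) .skip)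
    -- The loop bound may exceed the number of points, so the count is restricted to actual points.
    (fun k s' => s'.nvar 4 = 2 + ((Finset.range k).filter fun j => j < s.nvar 0 ∧
      Precedes s.rarr (s.nvar 7) (s.nvar 8) j (s.nvar 2)).card)
    (by simp [hs1]) (by
      intro k hk s' hs' hu hA hr ih
      have u0 : s'.nvar 0 = s.nvar 0 := by simpa [hs1] using hu 0 (by decide)
      have u2 : s'.nvar 2 = s.nvar 2 := by simpa [hs1] using hu 2 (by decide)
      have u7 : s'.nvar 7 = s.nvar 7 := by simpa [hs1] using hu 7 (by decide)
      have u8 : s'.nvar 8 = s.nvar 8 := by simpa [hs1] using hu 8 (by decide)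
      have ur : s'.rarr = s.rarr := by simpa [hs1] using hr
      rw [ForProg.eval, Finset.range_add_one, Finset.filter_insert]
      simp only [Test.Holds, Test.holds_either, NExp.eval, RExp.eval_along, u0, u2, u7, u8, ur,
        hs', ← precedes_iff]
      split_ifs with h1
      · rw [Finset.card_insert_of_notMem (by simp)]
        simp [ForProg.eval, NExp.eval, ih]
        omega
      · simp [ForProg.eval, ih])
  rw [computePosition, ForProg.eval, position]
  refine Eq.trans h ?_
  congr 2
  ext j
  simp only [hs1, State.setVar_nvar, Finset.mem_filter, Finset.mem_range,
    show ¬ 1 = 4 by decide, if_false]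
  constructor
  · rintro ⟨h1, h2, h3⟩
    exact ⟨h2, h3⟩
  · rintro ⟨h2, h3⟩
    exact ⟨by omega, h2, h3⟩

/-- The row of a point: `0` on the line through point `a`, and `1` on the other one. -/
noncomputable def rowOf (P : ℕ → ℕ → ℝ) (a b k : ℕ) : ℕ :=
  open Classical in if across P a b k = across P a b a then 0 else 1

/-- Points get distinct positions, so no entry is overwritten. The dummy position `0` keeps the
default row `0`, while the dummy `1` is put into row `1` explicitly; both are below all positions of
points. -/
theorem sortPoints_spec {s : State} (hm : s.nvar 0 ≤ s.nvar 1) (h5 : ∀ q, s.narr 5 q = 0) :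
    (∀ k < s.nvar 0,
      (sortPoints.eval s).narr 4 (position s.rarr (s.nvar 0) (s.nvar 7) (s.nvar 8) k) = k ∧
      (sortPoints.eval s).narr 5 (position s.rarr (s.nvar 0) (s.nvar 7) (s.nvar 8) k) =
        rowOf s.rarr (s.nvar 7) (s.nvar 8) k) ∧
    (sortPoints.eval s).narr 5 0 = 0 ∧ (sortPoints.eval s).narr 5 1 = 1 ∧
    ∀ q, (sortPoints.eval s).narr 5 q < 2 := by
  classical
  set pos := position s.rarr (s.nvar 0) (s.nvar 7) (s.nvar 8) with hpos
  set row := rowOf s.rarr (s.nvar 7) (s.nvar 8) with hrow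
  have hpos2 : ∀ k, 2 ≤ pos k := fun k => by simp [hpos, position]
  have hrow2 : ∀ k, row k < 2 := fun k => by
    rw [hrow, rowOf]
    split_ifs <;> decide
  have h := count_induction (v := 2) (s := s)
    (c := .branch (.nlt (.var 2) (.var 0))
        (.seq computePosition
          (.seq (.putN 4 (.var 4) (.var 2))
            (.branch
              (.req (.across (.var 7) (.var 8) (.var 2)) (.across (.var 7) (.var 8) (.var 7)))
              (.putN 5 (.var 4) (.const 0)) (.putN 5 (.var 4) (.const 1)))))
        .skip)
    (fun k s' => (∀ j < k, j < s.nvar 0 → s'.narr 4 (pos j) = j ∧ s'.narr 5 (pos j) = row j) ∧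
      s'.narr 5 0 = 0 ∧ ∀ q, s'.narr 5 q < 2)
    (by simp [h5]) (by
      rintro k hk s' hs' hu hA hr ⟨ih, ih0, ih2⟩
      have u0 : s'.nvar 0 = s.nvar 0 := hu 0 (by decide)
      have u1 : s'.nvar 1 = s.nvar 1 := hu 1 (by decide)
      have u7 : s'.nvar 7 = s.nvar 7 := hu 7 (by decide)
      have u8 : s'.nvar 8 = s.nvar 8 := hu 8 (by decide)
      rw [ForProg.eval]
      simp only [Test.Holds, NExp.eval, u0, hs']
      split_ifs with hkn
      · have hp : (computePosition.eval s').nvar 4 = pos k := by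
          rw [computePosition_spec (by omega), u0, u7, u8, hs', hr]
        have hv : ∀ u, u ∉ computePosition.vars → (computePosition.eval s').nvar u = s'.nvar u :=
          fun u hu => eval_nvar _ _ hu
        have ha : ∀ A, (computePosition.eval s').narr A = s'.narr A :=
          fun A => eval_narr _ _ (by simp [computePosition, arrs])
        have hfin : ∀ A, ((seq computePosition (.seq (.putN 4 (.var 4) (.var 2))
            (.branch
              (.req (.across (.var 7) (.var 8) (.var 2)) (.across (.var 7) (.var 8) (.var 7)))
              (.putN 5 (.var 4) (.const 0)) (.putN 5 (.var 4) (.const 1))))).eval s').narr A =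
            if A = 5 then Function.update (s'.narr 5) (pos k) (row k)
            else if A = 4 then Function.update (s'.narr 4) (pos k) k else s'.narr A := by
          intro A
          simp only [ForProg.eval, Test.Holds, NExp.eval, RExp.eval_across, State.putCell_nvar,
            State.putCell_rarr, hp, hv 2 (by decide), hv 7 (by decide), hv 8 (by decide), u7, u8,
            hs', eval_rarr, hr, hrow, rowOf]
          split_ifs with h1 h2 h2 <;> simp_all
        simp only [State.setVar_narr, hfin, if_true, show ¬ 4 = 5 by decide, if_false]
        refine ⟨fun j hj hjn => ?_, ?_, fun q => ?_⟩
        · rcases Nat.lt_succ_iff_lt_or_eq.1 hj with h | rfl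
          · have : pos j ≠ pos k := fun he => by
              have := position_injOn hjn hkn he
              omega
            rw [Function.update_of_ne this, Function.update_of_ne this]
            exact ih j h hjn
          · simp
        · rw [Function.update_of_ne (by have := hpos2 k; omega)]
          exact ih0
        · rw [Function.update_apply]
          split_ifs
          · exact hrow2 k
          · exact ih2 q
      · refine ⟨fun j hj hjn => ih j ?_ hjn, ih0, ih2⟩
        omega)
  obtain ⟨g1, g2, g3⟩ := h
  have e : ∀ A, (sortPoints.eval s).narr A = if A = 5 then _ else _ := fun A =>
    State.putCell_narr _ 5 1 1 A
  simp only [e, if_true, show ¬ 4 = 5 by decide, if_false]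
  refine ⟨fun k hk => ?_, ?_, ?_, fun q => ?_⟩
  · have : pos k ≠ 1 := by have := hpos2 k; omega
    rw [Function.update_of_ne this]
    exact g1 k (by omega) hk
  · rw [Function.update_of_ne (by decide)]
    exact g2
  · simp
  · rw [Function.update_apply]
    split_ifs
    · decide
    · exact g3 q

/-! ### Multiplication tables -/

/-- Fill array `A` with the multiples of the value of `e`. -/
def multiples (A : ℕ) (e : NExp) : ForProg :=
  .count 2 (.putN A (.add (.var 2) (.const 1)) (.add (.get A (.var 2)) e))

/-- Repeated addition replaces multiplication. The hypothesis on `e` keeps its value constant during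
the loop, which changes only the loop variable and array `A`. -/
theorem multiples_spec {A a : ℕ} {e : NExp} {s : State} (h0 : s.narr A 0 = 0)
    (he : ∀ s' : State, s'.nvar 1 = s.nvar 1 → (∀ B, B ≠ A → s'.narr B = s.narr B) →
      e.eval s' = a) :
    ∀ k ≤ s.nvar 1, ((multiples A e).eval s).narr A k = k * a := by
  refine count_induction (v := 2) (s := s)
    (c := .putN A (.add (.var 2) (.const 1)) (.add (.get A (.var 2)) e))
    (fun k s' => ∀ j ≤ k, s'.narr A j = j * a) ?_ ?_
  · intro j hj
    obtain rfl : j = 0 := by omega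
    simp [h0]
  · intro k hk s' hs' hu hA hr ih j hj
    have he' := he s' (hu 1 (by simp [vars])) (fun B hB => hA B (by simpa [arrs] using hB))
    simp only [ForProg.eval, NExp.eval, State.setVar_narr, State.putCell_narr, if_true, he', hs',
      ih k le_rfl, Function.update_apply]
    split_ifs with h
    · rw [h, Nat.succ_mul]
    · exact ih j (by omega)

/-- Tables of the multiples of the powers of the loop bound. -/
def makeTables : ForProg :=
  .seq (multiples 6 (.var 1))
    (.seq (multiples 7 (.get 6 (.var 1)))
      (.seq (multiples 8 (.get 7 (.var 1))) (multiples 9 (.get 8 (.var 1)))))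

/-- The arrays `6` to `9` hold the multiples of the powers of `m`. -/
def Tables (m : ℕ) (s : State) : Prop :=
  ∀ k ≤ m, s.narr 6 k = k * m ∧ s.narr 7 k = k * (m * m) ∧ s.narr 8 k = k * (m * (m * m)) ∧
    s.narr 9 k = k * (m * (m * (m * m)))

theorem makeTables_spec {s : State} (h : ∀ A, 6 ≤ A → s.narr A 0 = 0) :
    Tables (s.nvar 1) (makeTables.eval s) := by
  set m := s.nvar 1 with hm
  set s1 := (multiples 6 (.var 1)).eval s with hs1
  set s2 := (multiples 7 (.get 6 (.var 1))).eval s1 with hs2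
  set s3 := (multiples 8 (.get 7 (.var 1))).eval s2 with hs3
  set s4 := (multiples 9 (.get 8 (.var 1))).eval s3 with hs4
  have m1 : s1.nvar 1 = m := eval_nvar _ _ (by decide)
  have m2 : s2.nvar 1 = m := (eval_nvar _ _ (by decide)).trans m1
  have m3 : s3.nvar 1 = m := (eval_nvar _ _ (by decide)).trans m2
  have a1 : ∀ A, A ≠ 6 → s1.narr A = s.narr A := fun A hA =>
    eval_narr _ _ (by simpa [multiples, arrs] using hA)
  have a2 : ∀ A, A ≠ 7 → s2.narr A = s1.narr A := fun A hA =>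
    eval_narr _ _ (by simpa [multiples, arrs] using hA)
  have a3 : ∀ A, A ≠ 8 → s3.narr A = s2.narr A := fun A hA =>
    eval_narr _ _ (by simpa [multiples, arrs] using hA)
  have a4 : ∀ A, A ≠ 9 → s4.narr A = s3.narr A := fun A hA =>
    eval_narr _ _ (by simpa [multiples, arrs] using hA)
  have t1 : ∀ k ≤ m, s1.narr 6 k = k * m :=
    multiples_spec (h 6 (by decide)) (fun s' h1 _ => h1)
  have t2 : ∀ k ≤ m, s2.narr 7 k = k * (m * m) := by
    rw [← m1]
    refine multiples_spec (by rw [a1 7 (by decide)]; exact h 7 (by decide)) (fun s' h1 h2 => ?_)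
    simp only [NExp.eval, h1, h2 6 (by decide), m1]
    exact t1 m le_rfl
  have t3 : ∀ k ≤ m, s3.narr 8 k = k * (m * (m * m)) := by
    rw [← m2]
    refine multiples_spec (by rw [a2 8 (by decide), a1 8 (by decide)]; exact h 8 (by decide))
      (fun s' h1 h2 => ?_)
    simp only [NExp.eval, h1, h2 7 (by decide), m2]
    exact t2 m le_rfl
  have t4 : ∀ k ≤ m, s4.narr 9 k = k * (m * (m * (m * m))) := by
    rw [← m3]
    refine multiples_spec (by
      rw [a3 9 (by decide), a2 9 (by decide), a1 9 (by decide)]; exact h 9 (by decide))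
      (fun s' h1 h2 => ?_)
    simp only [NExp.eval, h1, h2 8 (by decide), m3]
    exact t3 m le_rfl
  intro k hk
  change s4.narr 6 k = _ ∧ s4.narr 7 k = _ ∧ s4.narr 8 k = _ ∧ s4.narr 9 k = _
  rw [t4 k hk, a4 6 (by decide), a4 7 (by decide), a4 8 (by decide), t3 k hk, a3 6 (by decide),
    a3 7 (by decide), t2 k hk, a2 6 (by decide), t1 k hk]
  exact ⟨rfl, rfl, rfl, rfl⟩

end RealRAM

namespace RealRAM

open ForProg Sweep

/-! ### The dynamic program

Array `2` holds the sweep state, array `3` the values of the sweep states, array `4` the points in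
sorted order, array `5` their rows; variable `10` holds the position. -/

/-- The cell of array `3` for the sweep state `σ` at position `q`. -/
def index (m q : ℕ) (σ : ℕ → ℕ) : ℕ :=
  q + m * (σ 0 + m * (σ 1 + m * (σ 2 + m * σ 3)))

theorem eq_of_digits {m a b a' b' : ℕ} (ha : a < m) (ha' : a' < m) (h : a + m * b = a' + m * b') :
    a = a' ∧ b = b' := by
  have h1 := congrArg (· % m) h
  have h2 := congrArg (· / m) h
  have hm : 0 < m := by omega
  simp only [Nat.add_mul_mod_self_left, Nat.mod_eq_of_lt ha, Nat.mod_eq_of_lt ha'] at h1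
  simp only [Nat.add_mul_div_left _ _ hm, Nat.div_eq_of_lt ha, Nat.div_eq_of_lt ha',
    zero_add] at h2
  exact ⟨h1, h2⟩

/-- Uniqueness of base `m` digits: writing one table entry cannot damage another. -/
theorem index_inj {m q q' : ℕ} {σ τ : ℕ → ℕ} (hq : q < m) (hq' : q' < m) (hσ : ∀ i < 4, σ i < m)
    (hτ : ∀ i < 4, τ i < m) (h : index m q σ = index m q' τ) :
    q = q' ∧ ∀ i < 4, σ i = τ i := by
  obtain ⟨h0, h⟩ := eq_of_digits hq hq' h
  obtain ⟨h1, h⟩ := eq_of_digits (hσ 0 (by decide)) (hτ 0 (by decide)) h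
  obtain ⟨h2, h⟩ := eq_of_digits (hσ 1 (by decide)) (hτ 1 (by decide)) h
  obtain ⟨h3, h⟩ := eq_of_digits (hσ 2 (by decide)) (hτ 2 (by decide)) h
  have hm : 0 < m := by omega
  refine ⟨h0, fun i hi => ?_⟩
  obtain rfl | rfl | rfl | rfl : i = 0 ∨ i = 1 ∨ i = 2 ∨ i = 3 := by omega
  · exact h1
  · exact h2
  · exact h3
  · exact h

/-- The expression for `index`, for the sweep state in array `2`. -/
def NExp.index (e : NExp) : NExp :=
  .add e (.add (.get 6 (.get 2 (.const 0))) (.add (.get 7 (.get 2 (.const 1)))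
    (.add (.get 8 (.get 2 (.const 2))) (.get 9 (.get 2 (.const 3))))))

theorem NExp.eval_index {s : State} {m : ℕ} (ht : Tables m s) (hσ : ∀ i < 4, s.narr 2 i < m)
    (e : NExp) : e.index.eval s = RealRAM.index m (e.eval s) (s.narr 2) := by
  simp only [NExp.index, NExp.eval, RealRAM.index, (ht _ (hσ 0 (by decide)).le).1,
    (ht _ (hσ 1 (by decide)).le).2.1, (ht _ (hσ 2 (by decide)).le).2.2.1,
    (ht _ (hσ 3 (by decide)).le).2.2.2]
  ring

/-- The test that cell `i` of the sweep state is the position of a point. -/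
def Test.valid (i : ℕ) : Test :=
  .both (.nlt (.const 1) (.get 2 (.const i)))
    (.nlt (.add (.get 2 (.const i)) (.const 1)) (.var 1))

/-- The test that the point in cell `i` of the sweep state is closest to the present one. -/
def Test.closest (i : ℕ) : Test :=
  .all (fun j => .implies (.valid j)
    (.neg (.rlt (.sqDist (.get 4 (.var 10)) (.get 4 (.get 2 (.const j))))
      (.sqDist (.get 4 (.var 10)) (.get 4 (.get 2 (.const i))))))) 4

/-- The test that the point in cell `i` of the sweep state has the colour of the present one. -/
def Test.sameColor (i : ℕ) : Test :=
  .neq (.get 0 (.get 4 (.get 2 (.const i)))) (.get 0 (.get 4 (.var 10)))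

/-- The test for `CandidatesOK`. -/
def Test.candidates : TieRule → Test
  | .all => .both (.any (fun i => .valid i) 4)
      (.all (fun i => .implies (.both (.valid i) (.closest i)) (.sameColor i)) 4)
  | .some => .any (fun i => .both (.valid i) (.both (.closest i) (.sameColor i))) 4

/-- The distance between positions that the program uses. -/
def sqDistAt (s : State) (i j : ℕ) : ℝ := sqDist s.rarr (s.narr 4 i) (s.narr 4 j)

/-- The colour of the point at a position. -/
def colorAt (s : State) (i : ℕ) : ℕ := s.narr 0 (s.narr 4 i)

theorem Test.holds_candidates {N : ℕ} {s : State} (hm : s.nvar 1 = N + 1) (tie : TieRule) :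
    (Test.candidates tie).Holds s ↔
      CandidatesOK N (sqDistAt s) (colorAt s) (s.nvar 10) (s.narr 2) tie := by
  have hv : ∀ i, (Test.valid i).Holds s ↔ 2 ≤ s.narr 2 i ∧ s.narr 2 i < N := fun i => by
    simp only [Test.valid, Test.Holds, NExp.eval, hm]
    omega
  have hc : ∀ i, (Test.closest i).Holds s ↔ ∀ j < 4, 2 ≤ s.narr 2 j → s.narr 2 j < N →
      sqDistAt s (s.nvar 10) (s.narr 2 i) ≤ sqDistAt s (s.nvar 10) (s.narr 2 j) := fun i => by
    simp only [Test.closest, Test.holds_all, Test.holds_implies, hv, Test.Holds, NExp.eval,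
      RExp.eval_sqDist, sqDistAt, not_lt, and_imp]
  cases tie with
  | all =>
    simp only [Test.candidates, CandidatesOK, Test.holds_all, Test.holds_any, Test.holds_implies,
      hv, hc, Test.Holds, Test.sameColor, NExp.eval, colorAt, and_imp]
  | some =>
    simp only [Test.candidates, CandidatesOK, Test.holds_any, hv, hc, Test.Holds, Test.sameColor,
      NExp.eval, colorAt, and_assoc]

/-- The condition at a position that is not selected. -/
def okAt (N : ℕ) (tie : TieRule) (s : State) (q : ℕ) (σ : ℕ → ℕ) : Prop :=
  CandidatesOK N (sqDistAt s) (colorAt s) q σ tie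

theorem okAt_congr (N : ℕ) (tie : TieRule) (s : State) (q : ℕ) (σ τ : ℕ → ℕ)
    (h : ∀ i < 4, σ i = τ i) : okAt N tie s q σ ↔ okAt N tie s q τ :=
  candidatesOK_congr N _ _ tie q σ τ h

/-- When the position in variable `10` is selected, find the best next position in its row, in
variable `13`, and the resulting value, in variable `12`. -/
def chooseNext : ForProg :=
  .seq (.putN 2 (.get 5 (.var 10)) (.var 10))
    (.seq (.setN 12 (.var 1))
      (.seq (.setN 13 (.const 0))
        (.count 11
          (.seq (.putN 2 (.add (.const 2) (.get 5 (.var 10))) (.var 11))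
            (.branch
              (.nlt (.get 3 (NExp.index (.add (.var 10) (.const 1)))) (.var 12))
              (.seq (.setN 12 (.get 3 (NExp.index (.add (.var 10) (.const 1)))))
                (.setN 13 (.var 11)))
              .skip)))))

theorem advance_lt {m : ℕ} {row σ : ℕ → ℕ} (hσ : ∀ i < 4, σ i < m) {q c : ℕ} (hq : q < m)
    (hc : c < m) : ∀ i < 4, advance row q c σ i < m := by
  intro i hi
  simp only [advance, Function.update_apply]
  split_ifs
  · exact hc
  · exact hq
  · exact hσ i hi

/-- The cell `2 + row q` of the sweep state serves as scratch space for the trial guesses, so the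
last claim describes the sweep state only up to overwriting that cell. This is what `markSelected`
needs to install the best guess. -/
theorem chooseNext_spec {s : State} {m : ℕ} (hm : s.nvar 1 = m) (ht : Tables m s)
    (hσ : ∀ i < 4, s.narr 2 i < m) (hq : s.nvar 10 < m) (f : ℕ → ℕ)
    (hf : ∀ c, f c = s.narr 3
      (index m (s.nvar 10 + 1) (advance (s.narr 5) (s.nvar 10) c (s.narr 2)))) :
    (chooseNext.eval s).nvar 12 = minBelow m f m ∧ (chooseNext.eval s).nvar 13 = argBelow m f m ∧
    ∀ c, Function.update ((chooseNext.eval s).narr 2) (2 + s.narr 5 (s.nvar 10)) c =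
      advance (s.narr 5) (s.nvar 10) c (s.narr 2) := by
  subst hm
  set m := s.nvar 1 with hm
  set q := s.nvar 10 with hq'
  set row := s.narr 5 with hrow
  set σ := s.narr 2 with hσ'
  set s1 := ((s.putCell 2 (row q) q).setVar 12 m).setVar 13 0 with hs1
  have h1 : s1.nvar 1 = m := by simp [hs1, hm]
  have h := count_induction (v := 11) (s := s1)
    (c := .seq (.putN 2 (.add (.const 2) (.get 5 (.var 10))) (.var 11))
            (.branch
              (.nlt (.get 3 (NExp.index (.add (.var 10) (.const 1)))) (.var 12))
              (.seq (.setN 12 (.get 3 (NExp.index (.add (.var 10) (.const 1)))))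
                (.setN 13 (.var 11)))
              .skip))
    (fun k s' => s'.nvar 12 = minBelow m f k ∧ s'.nvar 13 = argBelow m f k ∧
      ∀ c, Function.update (s'.narr 2) (2 + row q) c = advance row q c σ)
    (by simp [hs1, minBelow, argBelow, advance, hσ']) (by
      rintro k hk s' hs' hu hA hr ⟨i1, i2, i3⟩
      have u1 : s'.nvar 1 = m := (hu 1 (by decide)).trans h1
      have u10 : s'.nvar 10 = q := (hu 10 (by decide)).trans (by simp [hs1, hq'])
      have ha : ∀ A, A ≠ 2 → s'.narr A = s.narr A := fun A hA' =>
        (hA A (by simpa [arrs] using hA')).trans (by simp [hs1, hA'])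
      set s2 := s'.putCell 2 (2 + row q) k with hs2
      have hs2' : (ForProg.putN 2 (.add (.const 2) (.get 5 (.var 10))) (.var 11)).eval s' = s2 := by
        simp only [ForProg.eval, NExp.eval, u10, hs', ha 5 (by decide), hs2, hrow]
      have e2 : s2.narr 2 = advance row q k σ := by
        simp only [hs2, State.putCell_narr, if_true, i3]
      have ea : ∀ A, A ≠ 2 → s2.narr A = s.narr A := fun A hA' => by
        simp only [hs2, State.putCell_narr, if_neg hA', ha A hA']
      have ev : s2.nvar = s'.nvar := rfl
      have ht2 : Tables m s2 := by
        intro k hk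
        rw [ea 6 (by decide), ea 7 (by decide), ea 8 (by decide), ea 9 (by decide)]
        exact ht k hk
      have hkm : k < m := by omega
      have hidx : (NExp.get 3 (NExp.index (.add (.var 10) (.const 1)))).eval s2 = f k := by
        rw [NExp.eval, NExp.eval_index ht2 (by rw [e2]; exact advance_lt hσ hq hkm),
          ea 3 (by decide), e2, hf]
        simp only [NExp.eval, ev, u10]
      have e3 : ∀ c, Function.update (s2.narr 2) (2 + row q) c = advance row q c σ := by
        intro c
        rw [e2, advance, Function.update_idem, advance]
      rw [eval_seq, hs2', eval_branch]
      simp only [Test.Holds, hidx, minBelow, argBelow]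
      simp only [NExp.eval, ev, i1]
      split_ifs with hlt
      · simp only [ForProg.eval, State.setVar_nvar, State.setVar_narr, NExp.eval, ev, hs']
        refine ⟨?_, ?_, e3⟩
        · simp only [show ¬ 12 = 11 by decide, show ¬ 12 = 13 by decide, if_false, if_true]
          exact hidx
        · simp
      · simp only [ForProg.eval, State.setVar_nvar, State.setVar_narr, ev]
        exact ⟨by simpa using i1, by simpa using i2, e3⟩)
  rw [h1] at h
  exact h

/-! ### Correctness of the table -/

/-- Two states with the same input, sorted order and tables. -/
structure Agrees (s₀ s : State) : Prop where
  bound : s.nvar 1 = s₀.nvar 1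
  narr : ∀ A, A ∉ [1, 2, 3] → s.narr A = s₀.narr A
  rarr : s.rarr = s₀.rarr

theorem Agrees.eval {s₀ s : State} (h : Agrees s₀ s) (c : ForProg) (hc : c.proper = true)
    (hA : c.arrs ⊆ [1, 2, 3]) : Agrees s₀ (c.eval s) :=
  ⟨(eval_nvar _ _ (one_notMem_vars hc)).trans h.bound,
    fun A hA' => (eval_narr _ _ fun h => hA' (hA h)).trans (h.narr A hA'),
    (eval_rarr _ _).trans h.rarr⟩

theorem Agrees.setVar {s₀ s : State} (h : Agrees s₀ s) {v : ℕ} (hv : v ≠ 1) (a : ℕ) :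
    Agrees s₀ (s.setVar v a) :=
  ⟨by simpa [hv.symm] using h.bound, h.narr, h.rarr⟩

theorem Agrees.tables {s₀ s : State} {m : ℕ} (h : Agrees s₀ s) (ht : Tables m s₀) :
    Tables m s := by
  intro k hk
  rw [h.narr 6 (by decide), h.narr 7 (by decide), h.narr 8 (by decide), h.narr 9 (by decide)]
  exact ht k hk

/-- The condition depends only on coordinates, colours and the sorted order, so the recursion can be
stated once for the fixed state `s₀`. -/
theorem Agrees.okAt {s₀ s : State} (h : Agrees s₀ s) (N : ℕ) (tie : TieRule) :
    okAt N tie s = okAt N tie s₀ := by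
  have h1 : sqDistAt s = sqDistAt s₀ := by
    funext i j
    rw [sqDistAt, h.narr 4 (by decide), h.rarr, sqDistAt]
  have h2 : colorAt s = colorAt s₀ := by
    funext i
    rw [colorAt, h.narr 4 (by decide), h.narr 0 (by decide), colorAt]
  funext q σ
  rw [RealRAM.okAt, h1, h2, RealRAM.okAt]

/-- The value of the sweep state in array `2` at the position in variable `10`. -/
def computeValue (tie : TieRule) : ForProg :=
  .branch (.neq (.add (.var 10) (.const 1)) (.var 1))
    (.branch
      (.both (.neq (.get 2 (.const 2)) (.var 10)) (.neq (.get 2 (.const 3)) (.var 10)))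
      (.setN 12 (.const 0)) (.setN 12 (.var 1)))
    (.branch (.neq (.get 2 (.add (.const 2) (.get 5 (.var 10)))) (.var 10))
      (.seq chooseNext (.setN 12 (.add (.var 12) (.const 1))))
      (.branch (.candidates tie) (.setN 12 (.get 3 (NExp.index (.add (.var 10) (.const 1)))))
        (.setN 12 (.var 1))))

/-- Array `3` holds the values of the sweep states at the last positions. -/
def Solved (N : ℕ) (tie : TieRule) (s₀ : State) (K : ℕ) (D : ℕ → ℕ) : Prop :=
  ∀ j < K, ∀ σ : ℕ → ℕ, (∀ i < 4, σ i < N + 1) →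
    D (index (N + 1) (N - j) σ) = value N (s₀.narr 5) (okAt N tie s₀) j σ

/-- The standing assumptions on the state before the dynamic program. -/
structure Ready (N : ℕ) (s₀ : State) : Prop where
  bound : s₀.nvar 1 = N + 1
  tables : Tables (N + 1) s₀
  row_lt : ∀ q, s₀.narr 5 q < 2

/-- One step of the recursion for `value`. It reads only entries for the following position, which
are already correct; the loop bound `N + 1` plays the part of infinity. -/
theorem computeValue_spec {N : ℕ} {tie : TieRule} {s₀ s : State} (h₀ : Ready N s₀)
    (hs : Agrees s₀ s) (hσ : ∀ i < 4, s.narr 2 i < N + 1) {k : ℕ} (hk : k ≤ N)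
    (hq : s.nvar 10 = N - k) (hD : Solved N tie s₀ k (s.narr 3)) :
    ((computeValue tie).eval s).nvar 12 =
      value N (s₀.narr 5) (okAt N tie s₀) k (s.narr 2) := by
  have hm : s.nvar 1 = N + 1 := hs.bound.trans h₀.bound
  have h5 : s.narr 5 = s₀.narr 5 := hs.narr 5 (by decide)
  have ht := hs.tables h₀.tables
  rw [computeValue, eval_branch]
  simp only [Test.Holds, NExp.eval, hm, hq]
  cases k with
  | zero =>
    rw [if_pos (by omega), eval_branch, value]
    simp only [Test.Holds, NExp.eval, hq, Nat.sub_zero]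
    split_ifs
    · simp [ForProg.eval, NExp.eval]
    · simp [ForProg.eval, NExp.eval, hm]
  | succ k =>
    rw [if_neg (by omega), eval_branch, eval_branch, value]
    have hok : (Test.candidates tie).Holds s ↔ okAt N tie s₀ (N - (k + 1)) (s.narr 2) := by
      rw [Test.holds_candidates hm, ← hs.okAt, okAt, hq]
    have hq1 : N - (k + 1) + 1 = N - k := by omega
    rw [hok]
    simp only [Test.Holds, NExp.eval, hq, h5]
    split_ifs with h1 h2
    · have hc := chooseNext_spec hm ht hσ (by omega) _ fun c => rfl
      rw [eval_seq, ForProg.eval]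
      simp only [NExp.eval, State.setVar_nvar, if_true, hc.1]
      congr 1
      refine (below_congr _ fun c hcN => ?_).1
      rw [hq, hq1, h5]
      exact hD k (Nat.lt_succ_self k) _ (advance_lt hσ (by omega) hcN)
    · rw [ForProg.eval]
      simp only [State.setVar_nvar, if_true]
      rw [NExp.eval, NExp.eval_index ht hσ]
      simp only [NExp.eval, hq, hq1]
      exact hD k (Nat.lt_succ_self k) _ hσ
    · simp [ForProg.eval, NExp.eval, hm]

/-- Store the value of the sweep state in the variables `14` to `17`. -/
def fillCell (tie : TieRule) : ForProg :=
  .seq (.seq (.putN 2 (.const 0) (.var 14)) (.seq (.putN 2 (.const 1) (.var 15))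
      (.seq (.putN 2 (.const 2) (.var 16)) (.seq (.putN 2 (.const 3) (.var 17))
        (.setN 18 (NExp.index (.var 10)))))))
    (.seq (computeValue tie) (.putN 3 (.var 18) (.var 12)))

/-- Compute the values of all sweep states at all positions, the last one first. -/
def fillTable (tie : TieRule) : ForProg :=
  .count 19 (.seq (.setN 10 (.sub (.sub (.var 1) (.const 1)) (.var 19)))
    (nest [14, 15, 16, 17] (fillCell tie)))

/-- The address is saved in variable `18` before the value is computed, because `chooseNext` spoils
the sweep state in array `2`. -/
theorem fillCell_spec {N : ℕ} {tie : TieRule} {s₀ s : State} (h₀ : Ready N s₀)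
    (hs : Agrees s₀ s) (hσ : ∀ i < 4, s.nvar (14 + i) < N + 1) {k : ℕ} (hk : k ≤ N)
    (hq : s.nvar 10 = N - k) (hD : Solved N tie s₀ k (s.narr 3)) :
    ((fillCell tie).eval s).narr 3 =
      Function.update (s.narr 3) (index (N + 1) (N - k) fun i => s.nvar (14 + i))
        (value N (s₀.narr 5) (okAt N tie s₀) k fun i => s.nvar (14 + i)) := by
  set c : ForProg := .seq (.putN 2 (.const 0) (.var 14)) (.seq (.putN 2 (.const 1) (.var 15))
      (.seq (.putN 2 (.const 2) (.var 16)) (.seq (.putN 2 (.const 3) (.var 17))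
        (.setN 18 (NExp.index (.var 10)))))) with hc
  set s1 := c.eval s with hs1
  have h1 : Agrees s₀ s1 := hs.eval _ (by decide) (by decide)
  have h3 : s1.narr 3 = s.narr 3 := eval_narr _ _ (by decide)
  have h10 : s1.nvar 10 = N - k := (eval_nvar _ _ (by decide)).trans hq
  have h2 : ∀ i < 4, s1.narr 2 i = s.nvar (14 + i) := by
    intro i hi
    simp only [hs1, hc, ForProg.eval, State.setVar_narr, State.putCell_narr, State.putCell_nvar,
      if_true, NExp.eval, Function.update_apply]
    obtain rfl | rfl | rfl | rfl : i = 0 ∨ i = 1 ∨ i = 2 ∨ i = 3 := by omega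
    all_goals rfl
  have hσ1 : ∀ i < 4, s1.narr 2 i < N + 1 := fun i hi => by rw [h2 i hi]; exact hσ i hi
  have h18 : s1.nvar 18 = index (N + 1) (N - k) fun i => s.nvar (14 + i) := by
    have : s1.nvar 18 = (NExp.index (.var 10)).eval s1 := by
      simp [hs1, hc, ForProg.eval, NExp.eval, NExp.index]
    rw [this, NExp.eval_index (h1.tables h₀.tables) hσ1, NExp.eval, h10]
    simp only [index, h2 0 (by decide), h2 1 (by decide), h2 2 (by decide), h2 3 (by decide)]
  have hv : ((computeValue tie).eval s1).nvar 12 = _ :=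
    computeValue_spec h₀ h1 hσ1 hk h10 (by rw [h3]; exact hD)
  rw [fillCell, eval_seq, eval_seq, ← hc, ← hs1]
  rw [ForProg.eval]
  simp only [State.putCell_narr, if_true, NExp.eval]
  rw [eval_narr _ _ (by cases tie <;> decide), h3, eval_nvar _ _ (by cases tie <;> decide), h18, hv,
    value_congr h₀.row_lt (okAt_congr N tie s₀) k h2]

theorem fillTable_spec {N : ℕ} {tie : TieRule} {s₀ s : State} (h₀ : Ready N s₀)
    (hs : Agrees s₀ s) :
    Solved N tie s₀ (N + 1) (((fillTable tie).eval s).narr 3) := by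
  have hm : s.nvar 1 = N + 1 := hs.bound.trans h₀.bound
  have hprop : (fillCell tie).proper = true := by cases tie <;> decide
  have harr : (fillCell tie).arrs ⊆ [1, 2, 3] := by cases tie <;> decide
  have hvars : ∀ v ∈ [14, 15, 16, 17], v ∉ (fillCell tie).vars := by cases tie <;> decide
  have h10 : 10 ∉ (fillCell tie).vars := by cases tie <;> decide
  have h := count_induction (v := 19) (s := s)
    (c := .seq (.setN 10 (.sub (.sub (.var 1) (.const 1)) (.var 19)))
      (nest [14, 15, 16, 17] (fillCell tie)))
    (fun k s' => Agrees s₀ s' ∧ Solved N tie s₀ k (s'.narr 3))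
    ⟨hs.setVar (by decide) _, fun j hj => absurd hj (by omega)⟩ (by
      rintro k hk s' hs' - - - ⟨ha, ih⟩
      rw [hm] at hk
      have hm' : s'.nvar 1 = N + 1 := ha.bound.trans h₀.bound
      have e : (ForProg.setN 10 (.sub (.sub (.var 1) (.const 1)) (.var 19))).eval s' =
          s'.setVar 10 (N - k) := by
        simp only [ForProg.eval, NExp.eval, hm', hs', Nat.add_sub_cancel]
      rw [eval_seq, e]
      set I : State → Prop := fun s => Agrees s₀ s ∧ s.nvar 10 = N - k ∧
        Solved N tie s₀ k (s.narr 3) with hI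
      have hIs : I (s'.setVar 10 (N - k)) := ⟨ha.setVar (by decide) _, by simp, ih⟩
      have hI1 : ∀ s, I s → s.nvar 1 = N + 1 := fun s h => h.1.bound.trans h₀.bound
      have hIset : ∀ v ∈ [14, 15, 16, 17], ∀ s k, I s → I (s.setVar v k) := by
        rintro v hv s k ⟨g1, g2, g3⟩
        refine ⟨g1.setVar ?_ _, ?_, g3⟩
        · rintro rfl
          revert hv
          decide
        · have : 10 ≠ v := by
            rintro rfl
            revert hv
            decide
          simpa [this] using g2
      have hlt : ∀ s : State, (∀ v ∈ [14, 15, 16, 17], s.nvar v < N + 1) →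
          ∀ i < 4, s.nvar (14 + i) < N + 1 := by
        intro s h i hi
        refine h _ ?_
        simp
        omega
      have hIbody : ∀ s, I s → (∀ v ∈ [14, 15, 16, 17], s.nvar v < N + 1) →
          I ((fillCell tie).eval s) := by
        rintro s ⟨g1, g2, g3⟩ hb
        refine ⟨g1.eval _ hprop harr, by rw [eval_nvar _ _ h10, g2], ?_⟩
        rw [fillCell_spec h₀ g1 (hlt s hb) (by omega) g2 g3]
        intro j hj σ hσ
        -- The address contains the position as a digit, so entries for other positions survive.
        rw [Function.update_of_ne, g3 j hj σ hσ]
        intro he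
        have := (index_inj (by omega) (by omega) hσ (hlt s hb) he).1
        omega
      have hIend : I ((nest [14, 15, 16, 17] (fillCell tie)).eval (s'.setVar 10 (N - k))) :=
        nest_preserves (by decide) hvars hI1 hIset hIbody hIs
      refine ⟨hIend.1.setVar (by decide) _, fun j hj σ hσ => ?_⟩
      rcases Nat.lt_succ_iff_lt_or_eq.1 hj with hj | rfl
      · exact hIend.2.2 j hj σ hσ
      -- The entry of `σ` becomes correct in the round in which the loop variables spell `σ`, and
      -- any other round leaves it correct.
      · have hP : ∀ s : State, I s → (∀ v ∈ [14, 15, 16, 17], s.nvar v < N + 1) →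
            (s.narr 3 (index (N + 1) (N - j) σ) = value N (s₀.narr 5) (okAt N tie s₀) j σ ∨
              ∀ i < 4, σ i = s.nvar (14 + i)) →
            ((fillCell tie).eval s).narr 3 (index (N + 1) (N - j) σ) =
              value N (s₀.narr 5) (okAt N tie s₀) j σ := by
          rintro s ⟨g1, g2, g3⟩ hb h
          rw [fillCell_spec h₀ g1 (hlt s hb) (by omega) g2 g3, Function.update_apply]
          split_ifs with he
          · exact (value_congr h₀.row_lt (okAt_congr N tie s₀) j
              (index_inj (by omega) (by omega) hσ (hlt s hb) he).2).symm
          · rcases h with h | h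
            · exact h
            · refine absurd ?_ he
              simp only [index, h 0 (by decide), h 1 (by decide), h 2 (by decide),
                h 3 (by decide)]
        refine nest_reaches (I := I) (P := fun s => s.narr 3 (index (N + 1) (N - j) σ) =
            value N (s₀.narr 5) (okAt N tie s₀) j σ) (m := N + 1) (fun v => σ (v - 14)) (by decide)
          hvars hI1 ?_ hIset hIbody (fun _ _ _ _ h => h) (fun s h1 h2 h3 => hP s h1 h3 (Or.inl h2))
          (fun s h1 h2 => hP s h1 ?_ (Or.inr fun i hi => ?_)) hIs
        · intro v hv
          refine hσ _ ?_
          simp at hv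
          omega
        · intro v hv
          rw [h2 v hv]
          refine hσ _ ?_
          simp at hv
          omega
        · have := h2 (14 + i) (by simp; omega)
          rw [this, Nat.add_sub_cancel_left])
  rw [hm] at h
  exact h.2

/-! ### Reconstruction of the subset -/

/-- Follow the optimal choices and mark the selected points in array `1`. -/
def markSelected : ForProg :=
  .seq (.seq (.putN 2 (.const 0) (.const 0)) (.seq (.putN 2 (.const 1) (.const 0))
      (.seq (.putN 2 (.const 2) (.const 0)) (.putN 2 (.const 3) (.const 1)))))
    (.count 10
      (.branch
        (.both (.nlt (.add (.var 10) (.const 1)) (.var 1))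
          (.neq (.get 2 (.add (.const 2) (.get 5 (.var 10)))) (.var 10)))
        (.seq chooseNext
          (.seq (.putN 2 (.add (.const 2) (.get 5 (.var 10))) (.var 13))
            (.branch (.nlt (.const 1) (.var 10))
              (.putN 1 (.get 4 (.var 10)) (.const 1)) .skip)))
        .skip))

theorem optimal_lt {N : ℕ} {row : ℕ → ℕ} {ok : ℕ → (ℕ → ℕ) → Prop} {σ : ℕ → ℕ}
    (hσ : ∀ i < 4, σ i < N + 1) {q : ℕ} (hq : q ≤ N) :
    ∀ i < 4, optimal N row ok σ q i < N + 1 := by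
  induction q with
  | zero => exact hσ
  | succ q ih =>
    rw [optimal]
    split_ifs
    · exact advance_lt (ih (by omega)) (by omega) (argBelow_lt _ _ (by omega))
    · exact ih (by omega)

/-- The loop replays `optimal`: running `chooseNext` on the finished table recovers the minimising
guess, so no choices need to be stored. Dummy positions are followed but not marked. -/
theorem markSelected_spec {N : ℕ} {tie : TieRule} {s₀ s : State} (h₀ : Ready N s₀)
    (hs : Agrees s₀ s) (hN : 1 ≤ N) (hD : Solved N tie s₀ (N + 1) (s.narr 3))
    (h1 : ∀ i, s.narr 1 i = 0) :
    ∃ σ : ℕ → ℕ, σ 0 = 0 ∧ σ 1 = 0 ∧ σ 2 = 0 ∧ σ 3 = 1 ∧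
      ∀ i, (markSelected.eval s).narr 1 i =
        open Classical in if ∃ q, 2 ≤ q ∧ s₀.narr 4 q = i ∧
          q ∈ selected N (s₀.narr 5) (okAt N tie s₀) σ then 1 else 0 := by
  classical
  set c : ForProg := .seq (.putN 2 (.const 0) (.const 0)) (.seq (.putN 2 (.const 1) (.const 0))
      (.seq (.putN 2 (.const 2) (.const 0)) (.putN 2 (.const 3) (.const 1)))) with hc
  set s1 := c.eval s with hs1
  have ha1 : Agrees s₀ s1 := hs.eval _ (by decide) (by decide)
  have hm1 : s1.nvar 1 = N + 1 := ha1.bound.trans h₀.bound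
  have e3 : s1.narr 3 = s.narr 3 := eval_narr _ _ (by decide)
  have e1 : s1.narr 1 = s.narr 1 := eval_narr _ _ (by decide)
  set σ := s1.narr 2 with hσ'
  have e2 : σ 0 = 0 ∧ σ 1 = 0 ∧ σ 2 = 0 ∧ σ 3 = 1 := by
    simp [hσ', hs1, hc, ForProg.eval, NExp.eval]
  have hσ : ∀ i < 4, σ i < N + 1 := by
    intro i hi
    obtain rfl | rfl | rfl | rfl : i = 0 ∨ i = 1 ∨ i = 2 ∨ i = 3 := by omega
    all_goals omega
  refine ⟨σ, e2.1, e2.2.1, e2.2.2.1, e2.2.2.2, ?_⟩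
  have harr : chooseNext.arrs ++ [2, 1] ⊆ [1, 2, 3] := by decide
  have h := count_induction (v := 10) (s := s1)
    (c := .branch
        (.both (.nlt (.add (.var 10) (.const 1)) (.var 1))
          (.neq (.get 2 (.add (.const 2) (.get 5 (.var 10)))) (.var 10)))
        (.seq chooseNext
          (.seq (.putN 2 (.add (.const 2) (.get 5 (.var 10))) (.var 13))
            (.branch (.nlt (.const 1) (.var 10))
              (.putN 1 (.get 4 (.var 10)) (.const 1)) .skip)))
        .skip)
    -- The loop has `N + 1` rounds for `N` positions; the last round is idle, hence the minimum.
    (fun k s' => s'.narr 2 = optimal N (s₀.narr 5) (okAt N tie s₀) σ (min k N) ∧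
      ∀ i, s'.narr 1 i = if ∃ q < k, 2 ≤ q ∧ s₀.narr 4 q = i ∧
        q ∈ selected N (s₀.narr 5) (okAt N tie s₀) σ then 1 else 0)
    (by simp [optimal, e1, h1, hσ']) (by
      rintro k hk s' hs' hu hA hr ⟨i2, i1⟩
      rw [hm1] at hk
      have ha : Agrees s₀ s' :=
        ⟨(hu 1 (by decide)).trans ha1.bound,
          fun A hA' => (hA A fun h => hA' (harr h)).trans (ha1.narr A hA'),
          hr.trans ha1.rarr⟩
      have u1 : s'.nvar 1 = N + 1 := ha.bound.trans h₀.bound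
      have u3 : s'.narr 3 = s.narr 3 := (hA 3 (by decide)).trans e3
      have u5 : s'.narr 5 = s₀.narr 5 := ha.narr 5 (by decide)
      have hmin : min k N = k := min_eq_left (by omega)
      rw [hmin] at i2
      have hmem : k ∈ selected N (s₀.narr 5) (okAt N tie s₀) σ ↔
          k < N ∧ s'.narr 2 (2 + s'.narr 5 k) = k := by rw [mem_selected, i2, u5]
      have htest : (Test.both (.nlt (.add (.var 10) (.const 1)) (.var 1))
          (.neq (.get 2 (.add (.const 2) (.get 5 (.var 10)))) (.var 10))).Holds s' ↔
          k ∈ selected N (s₀.narr 5) (okAt N tie s₀) σ := by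
        rw [hmem]
        simp only [Test.Holds, NExp.eval, hs', u1, Nat.add_lt_add_iff_right]
      rw [eval_branch]
      by_cases hsel : k ∈ selected N (s₀.narr 5) (okAt N tie s₀) σ
      · rw [if_pos (htest.2 hsel)]
        have hkN := (hmem.1 hsel).1
        have hch := chooseNext_spec u1 (ha.tables h₀.tables) (s := s')
          (by rw [i2]; exact optimal_lt hσ hkN.le) (by omega) _ fun c => rfl
        rw [hs'] at hch
        obtain ⟨-, hc13, hc2⟩ := hch
        set s2 := chooseNext.eval s' with hs2
        have v10 : s2.nvar 10 = k := (eval_nvar _ _ (by decide)).trans hs'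
        have v5 : s2.narr 5 = s'.narr 5 := eval_narr _ _ (by decide)
        have v4 : s2.narr 4 = s₀.narr 4 :=
          (eval_narr _ _ (by decide)).trans (ha.narr 4 (by decide))
        have v1 : s2.narr 1 = s'.narr 1 := eval_narr _ _ (by decide)
        have hnext : advance (s'.narr 5) k (s2.nvar 13) (s'.narr 2) =
            optimal N (s₀.narr 5) (okAt N tie s₀) σ (k + 1) := by
          rw [optimal, if_pos (mem_selected.1 hsel).2, hc13, i2, u5]
          congr 1
          refine (below_congr _ fun c hc => ?_).2
          -- `Solved` indexes the table by the number of remaining positions.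
          rw [u3, show k + 1 = N - (N - (k + 1)) by omega]
          rw [hD (N - (k + 1)) (by omega) _
            (advance_lt (optimal_lt hσ hkN.le) (by omega) hc), show N - (N - (N - (k + 1))) =
              N - (k + 1) by omega]
        rw [eval_seq, ← hs2, eval_seq]
        set s3 := (ForProg.putN 2 (.add (.const 2) (.get 5 (.var 10))) (.var 13)).eval s2 with hs3
        have w2 : s3.narr 2 = optimal N (s₀.narr 5) (okAt N tie s₀) σ (k + 1) := by
          rw [hs3, ForProg.eval, State.putCell_narr, if_pos rfl, ← hnext, ← hc2]
          simp only [NExp.eval, v10, v5]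
        have w1 : s3.narr 1 = s'.narr 1 := (eval_narr _ _ (by decide)).trans v1
        have w10 : s3.nvar 10 = k := v10
        have w4 : s3.narr 4 = s₀.narr 4 := (eval_narr _ _ (by decide)).trans v4
        have hmin' : min (k + 1) N = k + 1 := min_eq_left hkN
        rw [hmin', eval_branch]
        simp only [Test.Holds, NExp.eval, w10]
        have hset : ∀ i, (∃ q < k + 1, 2 ≤ q ∧ s₀.narr 4 q = i ∧
            q ∈ selected N (s₀.narr 5) (okAt N tie s₀) σ) ↔
            (2 ≤ k ∧ i = s₀.narr 4 k) ∨ ∃ q < k, 2 ≤ q ∧ s₀.narr 4 q = i ∧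
            q ∈ selected N (s₀.narr 5) (okAt N tie s₀) σ := by
          intro i
          constructor
          · rintro ⟨q, h1, h2, h3, h4⟩
            rcases Nat.lt_succ_iff_lt_or_eq.1 h1 with h | rfl
            · exact Or.inr ⟨q, h, h2, h3, h4⟩
            · exact Or.inl ⟨h2, h3.symm⟩
          · rintro (⟨h1, rfl⟩ | ⟨q, h1, h2, h3, h4⟩)
            · exact ⟨k, Nat.lt_succ_self k, h1, rfl, hsel⟩
            · exact ⟨q, by omega, h2, h3, h4⟩
        simp only [hset]
        split_ifs with h2k
        · refine ⟨?_, fun i => ?_⟩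
          · simpa [ForProg.eval] using w2
          · simp only [ForProg.eval, NExp.eval, State.setVar_narr, State.putCell_narr, if_true,
              w10, w4, w1, Function.update_apply, i1]
            by_cases hi : i = s₀.narr 4 k
            · rw [if_pos hi, if_pos (Or.inl ⟨h2k, hi⟩)]
            · simp only [hi, and_false, false_or, if_false]
        · refine ⟨w2, fun i => ?_⟩
          have : ¬ 2 ≤ k := by omega
          simp only [ForProg.eval, State.setVar_narr, w1, i1, this, false_and, false_or]
      · rw [if_neg fun h => hsel (htest.1 h)]
        refine ⟨?_, fun i => ?_⟩
        · simp only [ForProg.eval, State.setVar_narr, i2]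
          rcases Nat.lt_or_ge k N with hkN | hkN
          · rw [min_eq_left hkN, optimal, if_neg]
            intro h
            exact hsel (mem_selected.2 ⟨hkN, h⟩)
          · rw [min_eq_right (by omega), show k = N by omega]
        · simp only [ForProg.eval, State.setVar_narr, i1]
          refine if_congr ⟨?_, ?_⟩ rfl rfl
          · rintro ⟨q, h1, h2⟩
            exact ⟨q, by omega, h2⟩
          · rintro ⟨q, h1, h2, h3, h4⟩
            refine ⟨q, ?_, h2, h3, h4⟩
            have : q ≠ k := fun h => hsel (h ▸ h4)
            omega)
  rw [hm1] at h
  intro i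
  have e : markSelected.eval s = (ForProg.count 10 _).eval s1 := rfl
  rw [e]
  refine (h.2 i).trans (if_congr ⟨?_, ?_⟩ rfl rfl)
  · rintro ⟨q, h1, h2⟩
    exact ⟨q, h2⟩
  · rintro ⟨q, h1, h2, h3⟩
    exact ⟨q, by have := (mem_selected.1 h3).1; omega, h1, h2, h3⟩

end RealRAM

/-! ## Geometry -/

namespace RealRAM

open Sweep

/-- The array holds the coordinates of the points. -/
def Holds {n : ℕ} (P : ℕ → ℕ → ℝ) (p : Fin n → EuclideanSpace ℝ (Fin 2)) : Prop :=
  ∀ k : Fin n, P 0 k = p k 0 ∧ P 1 k = p k 1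

section

variable {n : ℕ} {P : ℕ → ℕ → ℝ} {p : Fin n → EuclideanSpace ℝ (Fin 2)}

theorem Holds.eq_of_eq (hP : Holds P p) (hp : Function.Injective p) {j k : ℕ} (hj : j < n)
    (hk : k < n) (h0 : P 0 j = P 0 k) (h1 : P 1 j = P 1 k) : j = k := by
  have hj' := hP ⟨j, hj⟩
  have hk' := hP ⟨k, hk⟩
  have : p ⟨j, hj⟩ = p ⟨k, hk⟩ := by
    ext i
    fin_cases i
    · exact hj'.1.symm.trans (h0.trans hk'.1)
    · exact hj'.2.symm.trans (h1.trans hk'.2)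
  exact congrArg Fin.val (hp this)

theorem Holds.dist_le_iff (hP : Holds P p) (i j k : Fin n) :
    dist (p i) (p j) ≤ dist (p i) (p k) ↔ sqDist P i j ≤ sqDist P i k := by
  have h : ∀ j : Fin n, dist (p i) (p j) = √(sqDist P i j) := by
    intro j
    rw [EuclideanSpace.dist_eq, Fin.sum_univ_two, sqDist, (hP i).1, (hP i).2, (hP j).1, (hP j).2,
      Real.dist_eq, Real.dist_eq, sq_abs, sq_abs, sq, sq]
  rw [h, h, Real.sqrt_le_sqrt_iff]
  exact add_nonneg (mul_self_nonneg _) (mul_self_nonneg _)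

/-- Two distinct points of `L` span its direction, so `across` is constant on each of the parallel
lines; points with a value other than that of `a` are not on `L`, hence all on `L'`. -/
theorem Holds.isDirection (hP : Holds P p)
    (hp : Function.Injective p) {L L' : AffineSubspace ℝ (EuclideanSpace ℝ (Fin 2))}
    (hL : Module.finrank ℝ L.direction = 1) (hLL' : L'.direction = L.direction)
    (hmem : ∀ i, p i ∈ L ∨ p i ∈ L') {a b : Fin n} (hab : a ≠ b) (ha : p a ∈ L) (hb : p b ∈ L) :
    IsDirection P n a b := by
  have hv : p b -ᵥ p a ∈ L.direction := AffineSubspace.vsub_mem_direction hb ha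
  have hv0 : (⟨p b -ᵥ p a, hv⟩ : L.direction) ≠ 0 := by
    intro h
    have h' := congrArg Subtype.val h
    simp only [vsub_eq_sub, ZeroMemClass.coe_zero, sub_eq_zero] at h'
    exact hab (hp h').symm
  have hacross : ∀ k l : Fin n, p k -ᵥ p l ∈ L.direction → across P a b k = across P a b l := by
    intro k l hkl
    obtain ⟨c, hc⟩ := (finrank_eq_one_iff_of_nonzero' _ hv0).1 hL ⟨_, hkl⟩
    have hc' := congrArg Subtype.val hc
    have h0 := congrArg (fun x : EuclideanSpace ℝ (Fin 2) => x 0) hc'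
    have h1 := congrArg (fun x : EuclideanSpace ℝ (Fin 2) => x 1) hc'
    simp only [SetLike.val_smul, vsub_eq_sub, PiLp.smul_apply, PiLp.sub_apply, smul_eq_mul]
      at h0 h1
    simp only [across, (hP _).1, (hP _).2]
    -- Eliminates the scalar `c` between the two coordinates.
    linear_combination (p b 1 - p a 1) * h0 - (p b 0 - p a 0) * h1
  refine ⟨a.2, b.2, fun h => hab (Fin.ext h), fun k hk l hl h1 h2 => ?_⟩
  have hL' : ∀ k : Fin n, across P a b k ≠ across P a b a → p k ∈ L' := fun k h =>
    (hmem k).resolve_left fun hk => h (hacross k a (AffineSubspace.vsub_mem_direction hk ha))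
  exact hacross ⟨k, hk⟩ ⟨l, hl⟩ (hLL' ▸ AffineSubspace.vsub_mem_direction (hL' ⟨k, hk⟩ h1)
    (hL' ⟨l, hl⟩ h2))

/-- Either one of the lines carries two points, which give the direction, or each carries at most
one. Then there are only two points, and the line through them leaves none over. -/
theorem Holds.exists_isDirection (hP : Holds P p) (hp : Function.Injective p)
    (hlines : OnTwoParallelLines p) (hn : 2 ≤ n) : ∃ a b, IsDirection P n a b := by
  obtain ⟨L, L', hL, hpar, hmem⟩ := hlines
  have hdir := hpar.direction_eq
  by_cases h1 : ∃ a b, a ≠ b ∧ p a ∈ L ∧ p b ∈ L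
  · obtain ⟨a, b, hab, ha, hb⟩ := h1
    exact ⟨a, b, hP.isDirection hp hL hdir.symm hmem hab ha hb⟩
  by_cases h2 : ∃ a b, a ≠ b ∧ p a ∈ L' ∧ p b ∈ L'
  · obtain ⟨a, b, hab, ha, hb⟩ := h2
    exact ⟨a, b, hP.isDirection hp (hdir ▸ hL) hdir (fun i => (hmem i).symm) hab ha hb⟩
  push Not at h1 h2
  have hthree : ∀ a b k : Fin n, a ≠ b → k = a ∨ k = b := by
    intro a b k hab
    by_contra! h
    rcases hmem a with ha | ha <;> rcases hmem b with hb | hb <;> rcases hmem k with hk | hk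
    · exact h1 a b hab ha hb
    · exact h1 a b hab ha hb
    · exact h1 k a h.1 hk ha
    · exact h2 k b h.2 hk hb
    · exact h1 k b h.2 hk hb
    · exact h2 k a h.1 hk ha
    · exact h2 a b hab ha hb
    · exact h2 a b hab ha hb
  refine ⟨0, 1, by omega, by omega, by decide, fun k hk l hl h => absurd ?_ h⟩
  have := hthree ⟨0, by omega⟩ ⟨1, by omega⟩ ⟨k, hk⟩ (by simp)
  simp only [Fin.mk.injEq] at this
  rcases this with rfl | rfl
  · rfl
  · simp only [across]
    ring

/-- Up to the factor `|b - a|²`, the squared distance is the sum of the squared differences of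
`along` and of `across`. On one line the second term is the same, and the first decides; it does so
strictly, since distinct points of a line have distinct projections. -/
theorem Holds.sqDist_lt (hP : Holds P p) (hp : Function.Injective p) {a b : ℕ}
    (hab : IsDirection P n a b) {i j k : ℕ} (hj : j < n) (hk : k < n)
    (hjk : j ≠ k) (hrow : across P a b j = across P a b k)
    (h : along P a b j ≤ along P a b k ∧ along P a b k ≤ along P a b i ∨
      along P a b i ≤ along P a b k ∧ along P a b k ≤ along P a b j) :
    sqDist P i k < sqDist P i j := by
  have hnorm : 0 < (P 0 b - P 0 a) ^ 2 + (P 1 b - P 1 a) ^ 2 := by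
    by_contra! hle
    have h0 : P 0 b - P 0 a = 0 := by
      nlinarith [sq_nonneg (P 0 b - P 0 a), sq_nonneg (P 1 b - P 1 a)]
    have h1 : P 1 b - P 1 a = 0 := by
      nlinarith [sq_nonneg (P 0 b - P 0 a), sq_nonneg (P 1 b - P 1 a)]
    exact hab.2.2.1 (hP.eq_of_eq hp hab.1 hab.2.1 (by linarith) (by linarith))
  have hsq : ∀ j, ((P 0 b - P 0 a) ^ 2 + (P 1 b - P 1 a) ^ 2) * sqDist P i j =
      (along P a b i - along P a b j) ^ 2 + (across P a b i - across P a b j) ^ 2 := by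
    intro j
    simp only [sqDist, along, across]
    ring
  have hne : along P a b j ≠ along P a b k := by
    intro he
    have hz : (P 0 b - P 0 a) * (P 0 j - P 0 k) + (P 1 b - P 1 a) * (P 1 j - P 1 k) = 0 := by
      simp only [along] at he
      linarith
    have hz' : (P 0 b - P 0 a) * (P 1 j - P 1 k) - (P 1 b - P 1 a) * (P 0 j - P 0 k) = 0 := by
      simp only [across] at hrow
      linarith
    have h0 : ((P 0 b - P 0 a) ^ 2 + (P 1 b - P 1 a) ^ 2) * (P 0 j - P 0 k) = 0 := by
      linear_combination (P 0 b - P 0 a) * hz - (P 1 b - P 1 a) * hz'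
    have h1 : ((P 0 b - P 0 a) ^ 2 + (P 1 b - P 1 a) ^ 2) * (P 1 j - P 1 k) = 0 := by
      linear_combination (P 1 b - P 1 a) * hz + (P 0 b - P 0 a) * hz'
    have h0' := (mul_eq_zero.1 h0).resolve_left hnorm.ne'
    have h1' := (mul_eq_zero.1 h1).resolve_left hnorm.ne'
    exact hjk (hP.eq_of_eq hp hj hk (by linarith) (by linarith))
  refine lt_of_mul_lt_mul_left ?_ hnorm.le
  rw [hsq, hsq, hrow]
  refine add_lt_add_left ?_ _
  rcases h with ⟨h1, h2⟩ | ⟨h1, h2⟩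
  · have := lt_of_le_of_ne h1 hne
    nlinarith
  · have := lt_of_le_of_ne h2 hne.symm
    nlinarith

/-- The program's distances have the property that the sweep needs. -/
theorem Holds.monotone (hP : Holds P p) (hp : Function.Injective p) {a b : ℕ}
    (hab : 2 ≤ n → IsDirection P n a b) {order row : ℕ → ℕ}
    (horder : ∀ k < n, order (position P n a b k) = k)
    (hrow : ∀ k < n, row (position P n a b k) = rowOf P a b k) :
    Monotone (n + 2) row fun i j => sqDist P (order i) (order j) := by
  intro i j k hi hin hj hjn hk hkn hr hcase
  obtain ⟨i, hi', rfl⟩ := exists_position (P := P) (a := a) (b := b) hi hin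
  obtain ⟨j, hj', rfl⟩ := exists_position (P := P) (a := a) (b := b) hj hjn
  obtain ⟨k, hk', rfl⟩ := exists_position (P := P) (a := a) (b := b) hk hkn
  have hjk : j ≠ k := by
    rintro rfl
    omega
  -- Two different points `j` and `k` exist, so `2 ≤ n`.
  have hdir := hab (by omega)
  rw [hrow j hj', hrow k hk', rowOf, rowOf] at hr
  rw [position_lt_iff hj' hk', position_lt_iff hk' hi', position_lt_iff hi' hk',
    position_lt_iff hk' hj'] at hcase
  simp only [horder _ hi', horder _ hj', horder _ hk']
  have hle : ∀ {j k}, Precedes P a b j k → along P a b j ≤ along P a b k := fun h =>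
    h.elim le_of_lt fun h => h.1.le
  refine hP.sqDist_lt hp hdir hj' hk' hjk ?_ (hcase.imp (And.imp hle hle) (And.imp hle hle))
  split_ifs at hr with h1 h2 h2
  · exact h1.trans h2.symm
  · exact hdir.2.2.2 j hj' k hk' h1 h2

end

/-! ### Consistent subsets and sweep states -/

section

variable {n : ℕ} {p : Fin n → EuclideanSpace ℝ (Fin 2)} {col : Fin n → ℕ} {pos : Fin n → ℕ}
  {d : ℕ → ℕ → ℝ} {color row : ℕ → ℕ} {S : Finset ℕ} {A : Finset (Fin n)}

theorem closest_iff_isClosest (hpos : ∀ k, 2 ≤ pos k)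
    (hsurj : ∀ q, 2 ≤ q → q < n + 2 → ∃ k, pos k = q)
    (hd : ∀ i j k, dist (p i) (p j) ≤ dist (p i) (p k) ↔ d (pos i) (pos j) ≤ d (pos i) (pos k))
    (hS : S ⊆ Finset.range (n + 2)) (hA : ∀ k, k ∈ A ↔ pos k ∈ S) (i j : Fin n) :
    Closest d S (pos i) (pos j) ↔ IsClosest p A i j := by
  rw [Closest, IsClosest, hA, and_iff_right (hpos j)]
  refine and_congr_right fun _ => ⟨fun h k hk => ?_, fun h q hq hq2 => ?_⟩
  · exact (hd i j k).2 (h _ ((hA k).1 hk) (hpos k))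
  · obtain ⟨k, rfl⟩ := hsurj q hq2 (Finset.mem_range.1 (hS hq))
    exact (hd i j k).1 (h k ((hA k).2 hq))

/-- The dummies belong to `S`, so the conditions on unselected positions are exactly those on points
outside of `A`, and these see only their four candidates. -/
theorem isConsistentSubset_iff (tie : TieRule) (hpos : ∀ k, 2 ≤ pos k ∧ pos k < n + 2)
    (hsurj : ∀ q, 2 ≤ q → q < n + 2 → ∃ k, pos k = q)
    (hd : ∀ i j k, dist (p i) (p j) ≤ dist (p i) (p k) ↔ d (pos i) (pos j) ≤ d (pos i) (pos k))
    (hcol : ∀ k, color (pos k) = col k) (hrow : ∀ q, row q < 2) (hmono : Monotone (n + 2) row d)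
    (hS : S ⊆ Finset.range (n + 2)) (h0 : 0 ∈ S) (h1 : 1 ∈ S) (hA : ∀ k, k ∈ A ↔ pos k ∈ S) :
    IsConsistentSubset tie p col A ↔ ∀ q < n + 2, q ∉ S →
      CandidatesOK (n + 2) d color q (stateOf (n + 2) row S q) tie := by
  have hex : ∀ {i j}, Closest d S (pos i) j → ∃ k, pos k = j := fun h =>
    hsurj _ h.2.1 (Finset.mem_range.1 (hS h.1))
  have hcl := closest_iff_isClosest (fun k => (hpos k).1) hsurj hd hS hA
  have key : ∀ i : Fin n, i ∉ A → (ClosestHasSameColor p col A i tie ↔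
      CandidatesOK (n + 2) d color (pos i) (stateOf (n + 2) row S (pos i)) tie) := by
    intro i hi
    rw [hA] at hi
    cases tie with
    | all =>
      rw [candidatesOK_all_iff hrow hmono hS (hpos i).1 (hpos i).2 hi, ClosestHasSameColor]
      refine and_congr ⟨?_, ?_⟩ ⟨?_, ?_⟩
      · rintro ⟨j, hj⟩
        exact ⟨_, (hcl i j).2 hj⟩
      · rintro ⟨_, hj⟩
        obtain ⟨j, rfl⟩ := hex hj
        exact ⟨j, (hcl i j).1 hj⟩
      · intro h _ hj
        obtain ⟨j, rfl⟩ := hex hj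
        rw [hcol, hcol]
        exact h j ((hcl i j).1 hj)
      · intro h j hj
        rw [← hcol, ← hcol]
        exact h _ ((hcl i j).2 hj)
    | some =>
      rw [candidatesOK_some_iff hrow hmono hS (hpos i).1 (hpos i).2 hi, ClosestHasSameColor]
      constructor
      · rintro ⟨j, hj, hc⟩
        exact ⟨_, (hcl i j).2 hj, by rw [hcol, hcol, hc]⟩
      · rintro ⟨_, hj, hc⟩
        obtain ⟨j, rfl⟩ := hex hj
        exact ⟨j, (hcl i j).1 hj, by rw [← hcol, ← hcol, hc]⟩
  constructor
  · intro h q hq hqS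
    have hq2 : 2 ≤ q := by
      by_contra hlt
      obtain rfl | rfl : q = 0 ∨ q = 1 := by omega
      · exact hqS h0
      · exact hqS h1
    obtain ⟨i, rfl⟩ := hsurj q hq2 hq
    have hi : i ∉ A := by rwa [hA]
    exact (key i hi).1 (h i hi)
  · intro h i hi
    exact (key i hi).2 (h _ (hpos i).2 (by rwa [← hA]))

theorem card_eq_card_add_two (hpos : ∀ k, 2 ≤ pos k) (hinj : Function.Injective pos)
    (hsurj : ∀ q, 2 ≤ q → q < n + 2 → ∃ k, pos k = q)
    (hS : S ⊆ Finset.range (n + 2)) (h0 : 0 ∈ S) (h1 : 1 ∈ S) (hA : ∀ k, k ∈ A ↔ pos k ∈ S) :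
    S.card = A.card + 2 := by
  have : S = insert 0 (insert 1 (A.image pos)) := by
    ext q
    simp only [Finset.mem_insert, Finset.mem_image]
    constructor
    · intro hq
      by_cases hq2 : 2 ≤ q
      · obtain ⟨k, rfl⟩ := hsurj q hq2 (Finset.mem_range.1 (hS hq))
        exact Or.inr (Or.inr ⟨k, (hA k).2 hq, rfl⟩)
      · omega
    · rintro (rfl | rfl | ⟨k, hk, rfl⟩)
      · exact h0
      · exact h1
      · exact (hA k).1 hk
  have hne : ∀ q < 2, q ∉ A.image pos := by
    intro q hq h
    obtain ⟨k, -, rfl⟩ := Finset.mem_image.1 h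
    have := hpos k
    omega
  rw [this, Finset.card_insert_of_notMem, Finset.card_insert_of_notMem (hne 1 (by decide)),
    Finset.card_image_of_injective _ hinj]
  rw [Finset.mem_insert, not_or]
  exact ⟨by decide, hne 0 (by decide)⟩

theorem isMinConsistentSubset_of_selected (tie : TieRule)
    (hpos : ∀ k, 2 ≤ pos k ∧ pos k < n + 2) (hinj : Function.Injective pos)
    (hsurj : ∀ q, 2 ≤ q → q < n + 2 → ∃ k, pos k = q)
    (hd : ∀ i j k, dist (p i) (p j) ≤ dist (p i) (p k) ↔ d (pos i) (pos j) ≤ d (pos i) (pos k))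
    (hcol : ∀ k, color (pos k) = col k) (hrow : ∀ q, row q < 2) (hmono : Monotone (n + 2) row d)
    (hrow0 : row 0 = 0) (hrow1 : row 1 = 1) {σ : ℕ → ℕ} (h0 : σ 0 = 0) (h1 : σ 1 = 0)
    (h2 : σ 2 = 0) (h3 : σ 3 = 1)
    (hA : ∀ k, k ∈ A ↔
      pos k ∈ selected (n + 2) row (fun q σ => CandidatesOK (n + 2) d color q σ tie) σ) :
    IsMinConsistentSubset tie p col A := by
  obtain ⟨g0, g1, g2, g3⟩ := selected_minimal (N := n + 2) (by omega) hrow hrow0 hrow1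
    (fun q σ τ h => candidatesOK_congr (n + 2) d color tie q σ τ h) h0 h1 h2 h3
  have hS : selected (n + 2) row (fun q σ => CandidatesOK (n + 2) d color q σ tie) σ ⊆
    Finset.range (n + 2) := fun q hq => Finset.mem_range.2 (mem_selected.1 hq).1
  refine ⟨(isConsistentSubset_iff tie hpos hsurj hd hcol hrow hmono hS g0 g1 hA).2 g2,
    fun B hB => ?_⟩
  -- A competing subset becomes a competitor in the sweep by adding the dummies; both sizes shift by
  -- `2`.
  set T : Finset ℕ := insert 0 (insert 1 (B.image pos)) with hT
  have hTN : T ⊆ Finset.range (n + 2) := by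
    intro q hq
    simp only [hT, Finset.mem_insert, Finset.mem_image] at hq
    rw [Finset.mem_range]
    rcases hq with rfl | rfl | ⟨k, -, rfl⟩
    · omega
    · omega
    · exact (hpos k).2
  have hT0 : 0 ∈ T := by simp [hT]
  have hT1 : 1 ∈ T := by simp [hT]
  have hBT : ∀ k, k ∈ B ↔ pos k ∈ T := by
    intro k
    have := (hpos k).1
    simp only [hT, Finset.mem_insert, Finset.mem_image]
    constructor
    · exact fun hk => Or.inr (Or.inr ⟨k, hk, rfl⟩)
    · rintro (h | h | ⟨j, hj, h⟩)
      · omega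
      · omega
      · exact hinj h ▸ hj
  have hle := g3 T hTN hT0 hT1
    ((isConsistentSubset_iff tie hpos hsurj hd hcol hrow hmono hTN hT0 hT1 hBT).1 hB)
  have c1 := card_eq_card_add_two (fun k => (hpos k).1) hinj hsurj hS g0 g1 hA
  have c2 := card_eq_card_add_two (fun k => (hpos k).1) hinj hsurj hTN hT0 hT1 hBT
  omega

end

/-! ## The algorithm -/

open ForProg

/-- The algorithm for a minimum consistent subset, started with the loop bound `n + 3`. -/
def minConsistentSubset (tie : TieRule) : ForProg :=
  .seq findDirection (.seq sortPoints (.seq makeTables (.seq (fillTable tie) markSelected)))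

theorem minConsistentSubset_spec (tie : TieRule) {n : ℕ}
    {p : Fin n → EuclideanSpace ℝ (Fin 2)} (col : Fin n → ℕ) (hn : 1 ≤ n)
    (hp : Function.Injective p) (hlines : OnTwoParallelLines p) :
    ∃ A : Finset (Fin n),
      Returns ((minConsistentSubset tie).eval ((inputState p col).setVar 1 (n + 3))) A ∧
      IsMinConsistentSubset tie p col A := by
  classical
  set s := (inputState p col).setVar 1 (n + 3) with hs
  set P := s.rarr with hPdef
  have hP : Holds P p := by
    intro k
    simp [hPdef, hs, inputState]
  have hn0 : s.nvar 0 = n := by simp [hs, inputState]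
  have hn1 : s.nvar 1 = n + 3 := by simp [hs]
  have hzero : ∀ A, A ≠ 0 → ∀ i, s.narr A i = 0 := by
    intro A hA i
    simp [hs, inputState, hA]
  set s1 := findDirection.eval s with hs1
  have v10 : s1.nvar 0 = n := (eval_nvar _ _ (by decide)).trans hn0
  have v11 : s1.nvar 1 = n + 3 := (eval_nvar _ _ (by decide)).trans hn1
  have a1 : ∀ A, s1.narr A = s.narr A := fun A => eval_narr _ _ (by
    simp [findDirection, rejectDirection, nest, arrs])
  have r1 : s1.rarr = P := eval_rarr _ _
  set a := s1.nvar 7 with ha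
  set b := s1.nvar 8 with hb
  -- A single point determines no direction; in that case the order property needed by the sweep is
  -- vacuous.
  have hab : 2 ≤ n → IsDirection P n a b := fun h2 => by
    have := findDirection_spec (s := s) (by omega) (by
      rw [hn0]
      exact hP.exists_isDirection hp hlines h2)
    rwa [hn0] at this
  obtain ⟨hsort, hrow0, hrow1, hrow⟩ := sortPoints_spec (s := s1) (by omega)
    (by rw [a1]; exact hzero 5 (by decide))
  rw [v10, r1, ← ha, ← hb] at hsort
  set s2 := sortPoints.eval s1 with hs2
  have v21 : s2.nvar 1 = n + 3 := (eval_nvar _ _ (by decide)).trans v11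
  have a2 : ∀ A, A ∉ [4, 5] → s2.narr A = s.narr A := fun A hA =>
    (eval_narr _ _ fun h => hA ((by decide : sortPoints.arrs ⊆ [4, 5]) h)).trans (a1 A)
  have r2 : s2.rarr = P := (eval_rarr _ _).trans r1
  set s3 := makeTables.eval s2 with hs3
  have v31 : s3.nvar 1 = n + 3 := (eval_nvar _ _ (by decide)).trans v21
  have a3 : ∀ A, A ∉ [6, 7, 8, 9] → s3.narr A = s2.narr A := fun A hA =>
    eval_narr _ _ fun h => hA ((by decide : makeTables.arrs ⊆ [6, 7, 8, 9]) h)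
  have r3 : s3.rarr = P := (eval_rarr _ _).trans r2
  have h₀ : Ready (n + 2) s3 := by
    refine ⟨v31, ?_, fun q => by rw [a3 5 (by decide)]; exact hrow q⟩
    have := makeTables_spec (s := s2) fun A hA => by
      rw [a2 A (by simp; omega)]
      exact hzero A (by omega) 0
    rwa [v21] at this
  have hagree : Agrees s3 s3 := ⟨rfl, fun _ _ => rfl, rfl⟩
  have hsolved := fillTable_spec (tie := tie) h₀ hagree
  have hagree' : Agrees s3 ((fillTable tie).eval s3) :=
    hagree.eval _ (by cases tie <;> decide) (by cases tie <;> decide)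
  obtain ⟨σ, g0, g1, g2, g3, hout⟩ := markSelected_spec h₀ hagree' (by omega) hsolved (by
    rw [eval_narr _ _ (by cases tie <;> decide), a3 1 (by decide), a2 1 (by decide)]
    exact hzero 1 (by decide))
  have horder : ∀ k < n, s3.narr 4 (position P n a b k) = k := fun k hk => by
    rw [a3 4 (by decide)]
    exact (hsort k hk).1
  have hrowOf : ∀ k < n, s3.narr 5 (position P n a b k) = rowOf P a b k := fun k hk => by
    rw [a3 5 (by decide)]
    exact (hsort k hk).2
  have hpos : ∀ k : Fin n, 2 ≤ position P n a b k ∧ position P n a b k < n + 2 := fun k =>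
    ⟨by simp [position], position_lt k.2⟩
  have hsurj : ∀ q, 2 ≤ q → q < n + 2 → ∃ k : Fin n, position P n a b k = q := by
    intro q h1 h2
    obtain ⟨k, hk, rfl⟩ := exists_position (P := P) (a := a) (b := b) h1 h2
    exact ⟨⟨k, hk⟩, rfl⟩
  refine ⟨Finset.univ.filter fun k : Fin n =>
    position P n a b k ∈ selected (n + 2) (s3.narr 5) (okAt (n + 2) tie s3) σ, fun i => ?_, ?_⟩
  · rw [minConsistentSubset, eval_seq, eval_seq, eval_seq, eval_seq, ← hs1, ← hs2, ← hs3, hout]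
    refine if_congr ?_ rfl rfl
    rw [Finset.mem_filter, and_iff_right (Finset.mem_univ i)]
    constructor
    · rintro ⟨q, h1, h2, h3⟩
      obtain ⟨k, rfl⟩ := hsurj q h1 (mem_selected.1 h3).1
      rw [horder k k.2] at h2
      rwa [← Fin.ext h2]
    · intro h
      exact ⟨_, (hpos i).1, horder i i.2, h⟩
  · refine isMinConsistentSubset_of_selected (pos := fun k : Fin n => position P n a b k)
      (d := sqDistAt s3) (color := colorAt s3) (row := s3.narr 5) tie hpos
      (fun j k h => Fin.ext (position_injOn j.2 k.2 h)) hsurj ?_ ?_ h₀.row_lt ?_ ?_ ?_ g0 g1 g2 g3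
      fun k => by rw [Finset.mem_filter, and_iff_right (Finset.mem_univ k)]; rfl
    · intro i j k
      simp only [sqDistAt, horder _ i.2, horder _ j.2, horder _ k.2, r3]
      exact hP.dist_le_iff i j k
    · intro k
      rw [colorAt, horder k k.2, a3 0 (by decide), a2 0 (by decide)]
      simp [hs, inputState]
    · have := hP.monotone hp hab horder hrowOf
      rwa [← r3] at this
    · rw [a3 5 (by decide)]
      exact hrow0
    · rw [a3 5 (by decide)]
      exact hrow1

/-- The deepest part is `fillTable`: one loop for the position, four for the sweep state and one for
the guesses. -/
theorem minConsistentSubset_depth (tie : TieRule) : (minConsistentSubset tie).depth = 6 := by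
  cases tie <;> rfl

theorem minConsistentSubset_proper (tie : TieRule) :
    (minConsistentSubset tie).proper = true := by
  cases tie <;> decide

end RealRAM

/-! ### The main theorem -/

theorem theorem5 (tie : TieRule) :
    ∃ (prog : RealRAM.Prog) (C : ℕ),
      ∀ (n : ℕ) (p : Fin n → EuclideanSpace ℝ (Fin 2)) (col : Fin n → ℕ),
        1 ≤ n → Function.Injective p → OnTwoParallelLines p →
          ∃ (t : ℕ) (s : RealRAM.State) (S : Finset (Fin n)),
            RealRAM.Runs prog (inputState p col) t s ∧ t ≤ C * n ^ 6 ∧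
              Returns s S ∧ IsMinConsistentSubset tie p col S := by
  -- The loop bound `n + 3` counts the values `0, …, n + 2` of a cell: two dummies, `n` points, and
  -- `n + 2` for "none". Setting it costs `4`, and `n + 3 ≤ 4 * n` yields the factor `4 ^ 6`.
  refine ⟨.seq (.setN 1 (.add (.var 0) (.const 3)))
    (RealRAM.minConsistentSubset tie).toProg,
    4 + (RealRAM.minConsistentSubset tie).factor * 4 ^ 6, fun n p col hn hp hlines => ?_⟩
  obtain ⟨A, hA, hmin⟩ := RealRAM.minConsistentSubset_spec tie col hn hp hlines
  have h1 : ((inputState p col).setVar 1 (n + 3)).nvar 1 = n + 3 := by simp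
  obtain ⟨t, ht, hruns⟩ := RealRAM.ForProg.runs_toProg _
    (RealRAM.minConsistentSubset_proper tie) ((inputState p col).setVar 1 (n + 3)) (by omega)
  rw [RealRAM.minConsistentSubset_depth, h1] at ht
  refine ⟨_, _, A, RealRAM.Runs.seq (RealRAM.Runs.setN 1 (.add (.var 0) (.const 3)) _) hruns,
    ?_, hA, hmin⟩
  have h4 : (n + 3) ^ 6 ≤ 4 ^ 6 * n ^ 6 := by
    rw [← mul_pow]
    exact Nat.pow_le_pow_left (by omega) 6
  have h6 : 1 ≤ n ^ 6 := Nat.one_le_pow _ _ hn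
  have h5 := Nat.mul_le_mul_left (RealRAM.minConsistentSubset tie).factor h4
  simp only [RealRAM.NExp.cost]
  nlinarith
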